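/- Let $a,b,c>0$ and let $G=F222$ (space group No. 22) be the group of all $\{R|\mathbf t\}:\mathbf r\mapsto R\mathbf r+\mathbf t$, with $R\in D_2=\{E,C_{2,100},C_{2,010},C_{2,001}\}$ and $\mathbf t$ in the lattice generated by $\mathbf t_1=\frac12(0,b,c)$, $\mathbf t_2=\frac12(a,0,c)$, $\mathbf t_3=\frac12(a,b,0)$. Put $\mathbf t_z=\mathbf t_1+\mathbf t_2-\mathbf t_3=(0,0,c)$, $\mathbf g_1=2\pi(-\frac1a,\frac1b,\frac1c)$, $\mathbf g_2=2\pi(\frac1a,-\frac1b,\frac1c)$, $\mathbf g_3=2\pi(\frac1a,\frac1b,-\frac1c)$. Let $\mathbf q=(0,0,0)$ ($4a$) and $\mathbf q'=(0,0,\frac c2)$ ($4b$). A band representation of $G$ is given by unitary matrices $S^{\mathbf k}(h)$, $h\in G$, mapping states at $\mathbf k$ to states at $h\mathbf k=R\mathbf k$, that arise by induction from unitary representations of site-symmetry groups (finite direct sums, and smooth unitary changes of basis periodic under the reciprocal lattice, are allowed). A gauge transformation, i.e. a unitary-matrix-valued function $M_{\mathbf k}$, relates $S$ to $S'$ if $S'^{\mathbf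 k}(h)=M_{h\mathbf k}^\dagger S^{\mathbf k}(h)M_{\mathbf k}$ for all $\mathbf k$ and $h\in G$. $S,S'$ are irrep-equivalent if $\operatorname{Tr}S^{\mathbf k}(h)=\operatorname{Tr}S'^{\mathbf k}(h)$ whenever $h\mathbf k-\mathbf k$ is a reciprocal lattice vector, and homotopically equivalent if they are joined by a family of unitary band representations $S_\tau$, $\tau\in[0,1]$, whose matrix entries are smooth in $\mathbf k$ and jointly continuous in $(\tau,\mathbf k)$. An EBR is a band representation not homotopically equivalent to a direct sum of two nonzero ones. The maps $\{R|\mathbf v\}\mapsto R$ identify the site-symmetry groups $G_{\mathbf q}$ and $G_{\mathbf q'}$ with $D_2$, and all complex irreps of $D_2$ are one-dimensional. Let $\rho:D_2\to U(1)$ be one of them, and let $\rho_G$ and $\rho'_G$ be the band representations induced from the corresponding representations of $G_{\mathbf q}$ and of $G_{\mathbf q'}$. Then: 1. $\rho_G$ and $\rho'_G$ are EBRs, and for $R\in D_2$ and lattice vectors $\mathbf t$, $$\rho_G^{\mathbf k}(\{R|\mathbf t\})=e^{-i(R\mathbf k)\cdot\mathbf t}\rho(R),\qquad (\rho')_G^{\mathbf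 k}(\{R|\mathbf t\})=e^{-i(R\mathbf k)\cdot\mathbf t'}\rho(R),$$ where $\mathbf t'=\mathbf t$ if $R\in\{E,C_{2,001}\}$ and $\mathbf t'=\mathbf t-\mathbf t_z$ if $R\in\{C_{2,100},C_{2,010}\}$. 2. $\rho_G$ and $\rho'_G$ are irrep-equivalent but not homotopically equivalent. 3. $M_{\mathbf k}=e^{-ick_z/2}$ relates $\rho_G$ to $\rho'_G$. A gauge transformation $N$ relates them if and only if $N_{\mathbf k}=\varphi(\mathbf k)M_{\mathbf k}$ with $|\varphi|=1$ and $\varphi(R\mathbf k)=\varphi(\mathbf k)$ for all $R\in D_2$; in particular $M$ is the only one of the form $e^{-i\mathbf k\cdot\mathbf r}$. $M$ is not Brillouin-zone periodic ($M_{\mathbf k+\mathbf g_j}=-M_{\mathbf k}$ for $j=1,2,3$), and no continuous Brillouin-zone periodic gauge transformation relates $\rho_G$ to $\rho'_G$. 4. Consider a crystal with symmetry $G$ and an arbitrary Hilbert space of cell-periodic functions (spinless: a unitary action of $G$, trivial on lattice translations, together with the compatible multiplication operators $e^{i\mathbf K\cdot\mathbf r}$, $\mathbf K$ in the reciprocal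 lattice). Consider a single band with normalized cell-periodic Bloch functions $u_{\mathbf k}$, smooth in $\mathbf k$ and with $u_{\mathbf k+\mathbf K}=e^{-i\mathbf K\cdot\mathbf r}u_{\mathbf k}$, Berry connection $\mathbf A=i\langle u|\nabla u\rangle$, curvature $\Omega=\nabla\times\mathbf A$, and $W_{\mathbf K}=\exp(i\int\mathbf A\cdot d\mathbf l)$ along the segment from $0$ to $\mathbf K$. If the band is invariant under $G$, there is exactly one $n\in\mathbb Z_4$ such that $$e^{2\pi i n/4}=W_{\mathbf g_1}\,e^{-\frac i4\int_\Sigma\Omega\cdot d\Sigma}$$ for every piecewise smooth oriented surface $\Sigma$ (an integer combination of smooth maps of the unit square) whose boundary is the loop formed by $\mathbf g_1$, $\mathbf g_2$, $\mathbf g_3$, $-\mathbf g_1-\mathbf g_2-\mathbf g_3$ put end-to-end from the origin. If the band transforms as $\rho_G$ (up to a smooth Brillouin-zone periodic change of phase), it is invariant under $G$ and $n=0$; if it transforms as $\rho'_G$, it is invariant under $G$ and $n=2$. Bands of both kinds exist: when the Hilbert space consists of a single orbital at $\mathbf q$, respectively $\mathbf q'$, there is one with $\Omega=0$ and $W_{\mathbf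 g_j}=1$, respectively $\Omega=0$ and $W_{\mathbf g_j}=-1$, for $j=1,2,3$. -/

import Mathlib

open scoped ContDiff Matrix
open MeasureTheory

noncomputable section

namespace BandRep

/-! ### Crystals: space groups, lattices, site-symmetry groups, little groups

Real space and momentum space are both `Fin 3 → ℝ` (Cartesian coordinates), with the pairing
`k ⬝ᵥ r`.  Space groups are groups of affine transformations whose linear parts are orthogonal, so
that an element `{R|v}` acts on momenta by `k ↦ R k`. -/

/-- Three-dimensional space in Cartesian coordinates. -/
abbrev R3 := Fin 3 → ℝ

/-- Affine transformations of space. The Seitz symbol `{R|v}` is `r ↦ R r + v`: the rotational part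
`R` of `h` is `h.linear` and the translational part `v` is `h 0`. -/
abbrev Aff := R3 ≃ᵃ[ℝ] R3

/-- The translation `{E|t}`. -/
def translation (t : R3) : Aff := AffineEquiv.constVAdd ℝ R3 t

/-- The lattice of translations contained in `G`. -/
def latticeOf (G : Subgroup Aff) : AddSubgroup R3 where
  carrier := {t | translation t ∈ G}
  zero_mem' := by
    have : translation 0 = 1 := by ext r; simp [translation]
    simp [this, G.one_mem]
  add_mem' := by
    intro s t hs ht
    have : translation (s + t) = translation s * translation t := by
      ext r i; simp [translation]
    simpa [this] using G.mul_mem hs ht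
  neg_mem' := by
    intro t ht
    have : translation (-t) = (translation t)⁻¹ := by
      rw [eq_inv_iff_mul_eq_one]; ext r i; simp [translation]
    simpa [this] using G.inv_mem ht

/-- The reciprocal lattice: momenta `K` with `K · t ∈ 2π ℤ` for every lattice translation `t`. -/
def recipLattice (G : Subgroup Aff) : AddSubgroup R3 where
  carrier := {K | ∀ t ∈ latticeOf G, ∃ n : ℤ, K ⬝ᵥ t = 2 * Real.pi * n}
  zero_mem' := fun t _ => ⟨0, by simp⟩
  add_mem' := by
    intro K K' h h' t ht
    obtain ⟨n, hn⟩ := h t ht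
    obtain ⟨n', hn'⟩ := h' t ht
    exact ⟨n + n', by rw [add_dotProduct, hn, hn']; push_cast; ring⟩
  neg_mem' := by
    intro K h t ht
    obtain ⟨n, hn⟩ := h t ht
    exact ⟨-n, by rw [neg_dotProduct, hn]; push_cast; ring⟩

/-- The site-symmetry group `G_q = {g ∈ G | g q = q}`. -/
def siteGroup (G : Subgroup Aff) (q : R3) : Subgroup Aff where
  carrier := {g | g ∈ G ∧ g q = q}
  one_mem' := ⟨G.one_mem, by simp⟩
  mul_mem' := by
    rintro g h ⟨hg, hgq⟩ ⟨hh, hhq⟩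
    exact ⟨G.mul_mem hg hh, by simp [hhq, hgq]⟩
  inv_mem' := by
    rintro g ⟨hg, hgq⟩
    refine ⟨G.inv_mem hg, ?_⟩
    rw [AffineEquiv.inv_def]
    exact (AffineEquiv.symm_apply_eq g).2 hgq.symm

/-- The little group of `k`: the elements `{R|v}` of `G` with `R k ≡ k` modulo the reciprocal
lattice. -/
def littleGroup (G : Subgroup Aff) (k : R3) : Set G :=
  {h | (h : Aff).linear k - k ∈ recipLattice G}

/-! ### Band representations -/

/-- The data from which a band representation is induced: a site `q`, a unitary matrix
representation `ρ` of its site-symmetry group, and representatives `g_α` for the decomposition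
`G = ⋃_α T g_α G_q`, where `T` is the group of lattice translations. -/
structure Orbital (G : Subgroup Aff) where
  /-- the site `q` -/
  site : R3
  /-- the dimension of `ρ` -/
  dim : ℕ
  /-- the representation `ρ` -/
  rep : siteGroup G site →* Matrix.unitaryGroup (Fin dim) ℂ
  /-- the number of sites `g_α q` per primitive cell -/
  sites : ℕ
  /-- the representatives `g_α` -/
  coset : Fin sites → Aff
  coset_mem : ∀ α, coset α ∈ G
  coset_unique : ∀ h ∈ G, ∃! α, ∃ t ∈ latticeOf G, ∃ g ∈ siteGroup G site,
    h = translation t * coset α * g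

namespace Orbital

variable {G : Subgroup Aff}

open Classical in
/-- The extension `ρ̃` of `ρ` by zero outside `G_q`. -/
def repExt (D : Orbital G) (a : Aff) : Matrix (Fin D.dim) (Fin D.dim) ℂ :=
  if h : a ∈ siteGroup G D.site then (D.rep ⟨a, h⟩).1 else 0

/-- `t_{βα}(h) = h q_α - q_β`, where `q_α = g_α q`. -/
def shift (D : Orbital G) (h : Aff) (β α : Fin D.sites) : R3 :=
  h (D.coset α D.site) - D.coset β D.site

/-- The block `ρ_G^k(h)` of the induced band representation `ρ_G`, `h = {R|v}`:
`ρ_G^k(h)_{jβ,iα} = e^{-i (R k) · t_{βα}(h)} ρ̃_{ji}(g_β⁻¹ {E|-t_{βα}(h)} h g_α)`. -/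
def induced (D : Orbital G) (k : R3) (h : G) :
    Matrix (Fin D.dim × Fin D.sites) (Fin D.dim × Fin D.sites) ℂ :=
  fun jβ iα =>
    Complex.exp (-Complex.I * (((h : Aff).linear k ⬝ᵥ D.shift h jβ.2 iα.2 : ℝ) : ℂ)) *
      D.repExt ((D.coset jβ.2)⁻¹ * translation (-D.shift h jβ.2 iα.2) * h * D.coset iα.2) jβ.1 iα.1

end Orbital

/-- Matrix-valued functions `(k, h) ↦ S^k(h)`, the blocks of a band representation;
`S^k(h)` maps states at `k` to states at `h k`. -/
abbrev BandFun (G : Subgroup Aff) (ι : Type) := R3 → G → Matrix ι ι ℂ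

/-- `f` has the periodicity of the Brillouin zone. -/
def BZPeriodic (G : Subgroup Aff) {X : Type*} (f : R3 → X) : Prop :=
  ∀ K ∈ recipLattice G, ∀ k, f (k + K) = f k

/-- The gauge transformation `M` turns `S` into `S'`:
`S'^k(h) = M(h k)† S^k(h) M(k)` for all `k` and `h`. -/
def GaugeRelated {G : Subgroup Aff} {ι : Type} [Fintype ι]
    (M : R3 → Matrix ι ι ℂ) (S S' : BandFun G ι) : Prop :=
  ∀ k (h : G), S' k h = (M ((h : Aff).linear k))ᴴ * S k h * M k

/-- `S` is a band representation of `G`: the direct sum of finitely many representations induced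
from representations of site-symmetry groups, written in an arbitrary basis of Bloch functions
(obtained from the standard one by a smooth Brillouin-zone periodic unitary matrix). -/
def IsBandRep (G : Subgroup Aff) {ι : Type} [Fintype ι] [DecidableEq ι] (S : BandFun G ι) : Prop :=
  ∃ (r : ℕ) (D : Fin r → Orbital G)
    (e : ι ≃ Σ s, Fin (D s).dim × Fin (D s).sites) (U : R3 → Matrix ι ι ℂ),
    (∀ k, U k ∈ Matrix.unitaryGroup ι ℂ) ∧ (∀ i j, ContDiff ℝ ∞ fun k => U k i j) ∧
    BZPeriodic G U ∧
    GaugeRelated U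
      (fun k h => (Matrix.blockDiagonal' fun s => (D s).induced k h).submatrix e e) S

/-- Irrep-equivalence: the characters of all little groups agree. -/
def IrrepEquivalent {G : Subgroup Aff} {ι : Type} [Fintype ι] (S S' : BandFun G ι) : Prop :=
  ∀ k, ∀ h ∈ littleGroup G k, (S k h).trace = (S' k h).trace

/-- Homotopic equivalence: there is a family of unitary band representations `S_τ`, `τ ∈ [0,1]`,
smooth in `k` and continuous in `τ`, from `S` to `S'`. -/
def HomotopicallyEquivalent {G : Subgroup Aff} {ι : Type} [Fintype ι] [DecidableEq ι]
    (S S' : BandFun G ι) : Prop :=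
  ∃ F : unitInterval → BandFun G ι,
    (∀ τ, IsBandRep G (F τ)) ∧
    (∀ τ k h, F τ k h ∈ Matrix.unitaryGroup ι ℂ) ∧
    (∀ τ h i j, ContDiff ℝ ∞ fun k => F τ k h i j) ∧
    (∀ h i j, Continuous fun p : unitInterval × R3 => F p.1 p.2 h i j) ∧
    F 0 = S ∧ F 1 = S'

/-- An elementary band representation (EBR): a band representation that is not homotopically
equivalent to a direct sum of two band representations of positive rank. -/
def IsEBR {G : Subgroup Aff} {ι : Type} [Fintype ι] [DecidableEq ι] (S : BandFun G ι) : Prop :=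
  IsBandRep G S ∧
  ¬ ∃ (m n : ℕ) (S₁ : BandFun G (Fin m)) (S₂ : BandFun G (Fin n)) (e : ι ≃ Fin m ⊕ Fin n),
      0 < m ∧ 0 < n ∧ IsBandRep G S₁ ∧ IsBandRep G S₂ ∧
      HomotopicallyEquivalent S
        (fun k h => (Matrix.fromBlocks (S₁ k h) 0 0 (S₂ k h)).submatrix e e)

/-! ### Bands, Berry phases and Berry curvature -/

/-- The Hilbert space `H` of cell-periodic functions of a (spinless) crystal with space group `G`.
On it `boost K` is multiplication by `e^{i K · r}` for `K` in the reciprocal lattice, and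
`sym h` is the action `f ↦ f ∘ h⁻¹` of `h ∈ G` (combined with an action on orbital degrees of
freedom), which is trivial for lattice translations; for `h = {R|v}` one has
`sym h ∘ e^{i K · r} = e^{-i (R K) · v} e^{i (R K) · r} ∘ sym h`.
Continuum models, where `H` is the `L²` space of the unit cell, and tight-binding models, where `H`
is spanned by the orbitals in a unit cell, are both of this form. -/
structure BlochSpace (G : Subgroup Aff) (H : Type*) [NormedAddCommGroup H]
    [InnerProductSpace ℂ H] where
  /-- multiplication by `e^{i K · r}` -/
  boost : recipLattice G → (H ≃ₗᵢ[ℂ] H)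
  /-- action of the space group -/
  sym : G →* (H ≃ₗᵢ[ℂ] H)
  boost_add : ∀ K K' x, boost (K + K') x = boost K (boost K' x)
  sym_trans : ∀ h : G, (h : Aff).linear = LinearEquiv.refl ℝ R3 → sym h = 1
  sym_boost : ∀ (h : G) (K K' : recipLattice G), (K' : R3) = (h : Aff).linear K → ∀ x,
    sym h (boost K x) =
      Complex.exp (-Complex.I * (((K' : R3) ⬝ᵥ (h : Aff) 0 : ℝ) : ℂ)) • boost K' (sym h x)

section Band

variable {G : Subgroup Aff} {H : Type*} [NormedAddCommGroup H] [InnerProductSpace ℂ H]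

/-- `u(k)` is the normalized cell-periodic part of the Bloch functions `ψ_k = e^{i k · r} u(k)` of a
single band, in a smooth gauge with `ψ_{k+K} = ψ_k`, that is `e^{i K · r} u(k + K) = u(k)`. -/
def IsBand (X : BlochSpace G H) (u : R3 → H) : Prop :=
  ContDiff ℝ ∞ u ∧ (∀ k, ‖u k‖ = 1) ∧ ∀ (K : recipLattice G) (k : R3), X.boost K (u (k + K)) = u k

/-- The band is invariant under `G`: every `h ∈ G` maps the state at `k` to a multiple of the state
at `h k`. -/
def IsSymmetricBand (X : BlochSpace G H) (u : R3 → H) : Prop :=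
  IsBand X u ∧ ∀ (h : G) k, ∃ z : ℂ, X.sym h (u k) = z • u ((h : Aff).linear k)

/-- The Bloch functions transform by exactly the blocks of the rank-one `S`:
`h ψ_k = S^k(h) ψ_{h k}`. In terms of `u`, with `h = {R|v}`, this reads
`e^{-i (R k) · v} (sym h) u(k) = S^k(h) u(R k)`. -/
def TransformsExactly (X : BlochSpace G H) (S : BandFun G (Fin 1 × Fin 1))
    (u : R3 → H) : Prop :=
  ∀ (h : G) k,
    Complex.exp (-Complex.I * (((h : Aff).linear k ⬝ᵥ (h : Aff) 0 : ℝ) : ℂ)) • X.sym h (u k) =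
      S k h (0, 0) (0, 0) • u ((h : Aff).linear k)

/-- The band `u` transforms as the rank-one band representation `S`: its Bloch functions do so
exactly after a smooth Brillouin-zone periodic gauge transformation. -/
def TransformsAs (X : BlochSpace G H) (S : BandFun G (Fin 1 × Fin 1))
    (u : R3 → H) : Prop :=
  IsBand X u ∧ ∃ M : R3 → ℂ, ContDiff ℝ ∞ M ∧ (∀ k, ‖M k‖ = 1) ∧ BZPeriodic G M ∧
    TransformsExactly X S (fun k => M k • u k)

/-- The Berry connection `A_j = i ⟨u | ∂_j u⟩` (a real number, as `u` is normalized). -/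
def berryConnection (u : R3 → H) (k : R3) : R3 :=
  fun j => (Complex.I * inner ℂ (u k) (fderiv ℝ u k (Pi.single j 1))).re

/-- The curl of a vector field. -/
def curl (A : R3 → R3) (k : R3) : R3 :=
  let d (i j : Fin 3) : ℝ := fderiv ℝ A k (Pi.single i 1) j
  ![d 1 2 - d 2 1, d 2 0 - d 0 2, d 0 1 - d 1 0]

/-- The Berry curvature `Ω = ∇ × A`. -/
def berryCurvature (u : R3 → H) : R3 → R3 := curl (berryConnection u)

/-- The Berry phase `W_K = exp(i ∫ A · dl)` along the straight path from the origin to `K`. -/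
def wilson (u : R3 → H) (K : R3) : ℂ :=
  Complex.exp (Complex.I * ((∫ x in (0 : ℝ)..1, berryConnection u (x • K) ⬝ᵥ K : ℝ) : ℂ))

end Band

/-! ### Surfaces in momentum space

An oriented piecewise smooth surface is an integer combination of smooth maps of the unit square
(maps that collapse a side give triangles). -/

/-- A smooth parametrized square. -/
abbrev Patch := {σ : ℝ × ℝ → R3 // ContDiff ℝ ∞ σ}

/-- Formal integer combinations of parametrized paths. -/
abbrev Chain1 := (unitInterval → R3) →₀ ℤ

/-- A surface: a formal integer combination of smooth parametrized squares. -/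
abbrev Chain2 := Patch →₀ ℤ

/-- A single path. -/
def path (γ : ℝ → R3) : Chain1 := Finsupp.single (fun x => γ x) 1

/-- The straight segment from `p` to `q`. -/
def seg (p q : R3) : Chain1 := path fun x => p + x • (q - p)

/-- The boundary of the square, counterclockwise. -/
def patchBoundary (σ : Patch) : Chain1 :=
  path (fun s => σ.1 (s, 0)) + path (fun t => σ.1 (1, t))
    - path (fun s => σ.1 (s, 1)) - path (fun t => σ.1 (0, t))

/-- The boundary of a surface. -/
def boundary (Sg : Chain2) : Chain1 := Sg.sum fun σ n => n • patchBoundary σ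

/-- The combinations of paths that count as zero: constant paths, and the sum of a path and its
reverse. -/
def trivialChains : AddSubgroup Chain1 :=
  AddSubgroup.closure
    ({c | ∃ p : R3, c = Finsupp.single (fun _ => p) 1} ∪
     {c | ∃ γ : unitInterval → R3,
        c = Finsupp.single γ 1 + Finsupp.single (fun x => γ (unitInterval.symm x)) 1})

/-- The flux `∫_σ Ω · dΣ` of a vector field through a parametrized square. -/
def patchFlux (Ω : R3 → R3) (σ : Patch) : ℝ :=
  ∫ s in (0 : ℝ)..1, ∫ t in (0 : ℝ)..1,
    Ω (σ.1 (s, t)) ⬝ᵥ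
      crossProduct (fderiv ℝ σ.1 (s, t) (1, 0)) (fderiv ℝ σ.1 (s, t) (0, 1))

/-- The flux of a vector field through a surface. -/
def flux (Ω : R3 → R3) (Sg : Chain2) : ℝ := Sg.sum fun σ n => (n : ℝ) * patchFlux Ω σ

end BandRep

namespace F222

open BandRep

/-! ### The space group `F222` -/

/-- The diagonal linear map with diagonal entries the signs `ε`. -/
def diagRot (ε : Fin 3 → ℤˣ) : R3 ≃ₗ[ℝ] R3 where
  toFun v i := ((ε i : ℤ) : ℝ) * v i
  invFun v i := ((ε i : ℤ) : ℝ) * v i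
  map_add' v w := by ext i; simp [mul_add]
  map_smul' r v := by ext i; simp [mul_left_comm]
  left_inv v := by ext i; change _ * (_ * _) = _; rw [← mul_assoc, ← Int.cast_mul, ← Units.val_mul]; simp
  right_inv v := by ext i; change _ * (_ * _) = _; rw [← mul_assoc, ← Int.cast_mul, ← Units.val_mul]; simp

/-- The two-fold rotation about the `x` axis. -/
def C2x : R3 ≃ₗ[ℝ] R3 := diagRot ![1, -1, -1]
/-- The two-fold rotation about the `y` axis. -/
def C2y : R3 ≃ₗ[ℝ] R3 := diagRot ![-1, 1, -1]
/-- The two-fold rotation about the `z` axis. -/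
def C2z : R3 ≃ₗ[ℝ] R3 := diagRot ![-1, -1, 1]

theorem C2x_apply (v : R3) : C2x v = ![v 0, -v 1, -v 2] := by
  ext i; fin_cases i <;> simp [C2x, diagRot]
theorem C2y_apply (v : R3) : C2y v = ![-v 0, v 1, -v 2] := by
  ext i; fin_cases i <;> simp [C2y, diagRot]
theorem C2z_apply (v : R3) : C2z v = ![-v 0, -v 1, v 2] := by
  ext i; fin_cases i <;> simp [C2z, diagRot]

/-- The point group `D₂ = {E, C_{2,100}, C_{2,010}, C_{2,001}}`. -/
def D2 : Subgroup (R3 ≃ₗ[ℝ] R3) where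
  carrier := {1, C2x, C2y, C2z}
  one_mem' := by simp
  mul_mem' := by
    have h : ∀ f g k : R3 ≃ₗ[ℝ] R3, (∀ v, f (g v) = k v) → f * g = k :=
      fun f g k hk => LinearEquiv.ext hk
    have e1 : C2x * C2x = 1 := h _ _ _ fun v => by
      ext i; fin_cases i <;> simp [C2x_apply]
    have e2 : C2y * C2y = 1 := h _ _ _ fun v => by
      ext i; fin_cases i <;> simp [C2y_apply]
    have e3 : C2z * C2z = 1 := h _ _ _ fun v => by
      ext i; fin_cases i <;> simp [C2z_apply]
    have e4 : C2x * C2y = C2z := h _ _ _ fun v => by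
      ext i; fin_cases i <;> simp [C2x_apply, C2y_apply, C2z_apply]
    have e5 : C2y * C2x = C2z := h _ _ _ fun v => by
      ext i; fin_cases i <;> simp [C2x_apply, C2y_apply, C2z_apply]
    have e6 : C2x * C2z = C2y := h _ _ _ fun v => by
      ext i; fin_cases i <;> simp [C2x_apply, C2y_apply, C2z_apply]
    have e7 : C2z * C2x = C2y := h _ _ _ fun v => by
      ext i; fin_cases i <;> simp [C2x_apply, C2y_apply, C2z_apply]
    have e8 : C2y * C2z = C2x := h _ _ _ fun v => by
      ext i; fin_cases i <;> simp [C2x_apply, C2y_apply, C2z_apply]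
    have e9 : C2z * C2y = C2x := h _ _ _ fun v => by
      ext i; fin_cases i <;> simp [C2x_apply, C2y_apply, C2z_apply]
    rintro f g (rfl | rfl | rfl | rfl) (rfl | rfl | rfl | rfl) <;>
      simp [e1, e2, e3, e4, e5, e6, e7, e8, e9]
  inv_mem' := by
    have h : ∀ f : R3 ≃ₗ[ℝ] R3, (∀ v, f (f v) = v) → f⁻¹ = f :=
      fun f hf => inv_eq_of_mul_eq_one_left (LinearEquiv.ext hf)
    have e1 : C2x⁻¹ = C2x := h _ fun v => by ext i; fin_cases i <;> simp [C2x_apply]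
    have e2 : C2y⁻¹ = C2y := h _ fun v => by ext i; fin_cases i <;> simp [C2y_apply]
    have e3 : C2z⁻¹ = C2z := h _ fun v => by ext i; fin_cases i <;> simp [C2z_apply]
    rintro f (rfl | rfl | rfl | rfl) <;> simp [e1, e2, e3]

/-- First primitive lattice vector. -/
def t1 (_a b c : ℝ) : R3 := ![0, b / 2, c / 2]
/-- Second primitive lattice vector. -/
def t2 (a _b c : ℝ) : R3 := ![a / 2, 0, c / 2]
/-- Third primitive lattice vector. -/
def t3 (a b _c : ℝ) : R3 := ![a / 2, b / 2, 0]

/-- `t_z = t₁ + t₂ - t₃`, which is `(0, 0, c)`. -/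
def tz (a b c : ℝ) : R3 := t1 a b c + t2 a b c - t3 a b c

/-- The face-centered lattice. -/
def lattice (a b c : ℝ) : AddSubgroup R3 :=
  AddSubgroup.closure {t1 a b c, t2 a b c, t3 a b c}

/-- First reciprocal lattice vector. -/
def g1 (a b c : ℝ) : R3 := ![-(2 * Real.pi / a), 2 * Real.pi / b, 2 * Real.pi / c]
/-- Second reciprocal lattice vector. -/
def g2 (a b c : ℝ) : R3 := ![2 * Real.pi / a, -(2 * Real.pi / b), 2 * Real.pi / c]
/-- Third reciprocal lattice vector. -/
def g3 (a b c : ℝ) : R3 := ![2 * Real.pi / a, 2 * Real.pi / b, -(2 * Real.pi / c)]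

theorem t1_mem (a b c : ℝ) : t1 a b c ∈ lattice a b c := AddSubgroup.subset_closure (by simp)
theorem t2_mem (a b c : ℝ) : t2 a b c ∈ lattice a b c := AddSubgroup.subset_closure (by simp)
theorem t3_mem (a b c : ℝ) : t3 a b c ∈ lattice a b c := AddSubgroup.subset_closure (by simp)
theorem tz_mem (a b c : ℝ) : tz a b c ∈ lattice a b c :=
  sub_mem (add_mem (t1_mem a b c) (t2_mem a b c)) (t3_mem a b c)

theorem rot_mem_lattice {a b c : ℝ} {f : R3 ≃ₗ[ℝ] R3} (hf : f ∈ D2) {t : R3}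
    (ht : t ∈ lattice a b c) : f t ∈ lattice a b c := by
  have h1 := t1_mem a b c
  have h2 := t2_mem a b c
  have h3 := t3_mem a b c
  induction ht using AddSubgroup.closure_induction with
  | zero => rw [map_zero]; exact zero_mem _
  | add x y _ _ hx hy => rw [map_add]; exact add_mem hx hy
  | neg x _ hx => rw [map_neg]; exact neg_mem hx
  | mem x hx =>
    rcases hf with rfl | rfl | rfl | rfl
    · exact AddSubgroup.subset_closure hx
    · rcases hx with rfl | rfl | rfl
      · convert neg_mem h1 using 1; ext i; fin_cases i <;> simp [C2x_apply, t1]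
      · convert sub_mem h3 h1 using 1; ext i; fin_cases i <;> simp [C2x_apply, t1, t2, t3]
      · convert sub_mem h2 h1 using 1; ext i; fin_cases i <;> simp [C2x_apply, t1, t2, t3]
    · rcases hx with rfl | rfl | rfl
      · convert sub_mem h3 h2 using 1; ext i; fin_cases i <;> simp [C2y_apply, t1, t2, t3]
      · convert neg_mem h2 using 1; ext i; fin_cases i <;> simp [C2y_apply, t2]
      · convert sub_mem h1 h2 using 1; ext i; fin_cases i <;> simp [C2y_apply, t1, t2, t3]
    · rcases hx with rfl | rfl | rfl
      · convert sub_mem h2 h3 using 1; ext i; fin_cases i <;> simp [C2z_apply, t1, t2, t3]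
      · convert sub_mem h1 h3 using 1; ext i; fin_cases i <;> simp [C2z_apply, t1, t2, t3]
      · convert neg_mem h3 using 1; ext i; fin_cases i <;> simp [C2z_apply, t3]

theorem aff_apply (h : Aff) (r : R3) : h r = h.linear r + h 0 := by
  have := h.map_vadd 0 r
  simpa using this

/-- The space group `F222` (No. 22) with conventional cell `a × b × c`: all `{R|t}` with `R` in
`D₂` and `t` in the face-centered lattice. -/
def G (a b c : ℝ) : Subgroup Aff where
  carrier := {h | h.linear ∈ D2 ∧ h 0 ∈ lattice a b c}
  one_mem' := ⟨D2.one_mem, by simp⟩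
  mul_mem' := by
    rintro f g ⟨hf, hf0⟩ ⟨hg, hg0⟩
    refine ⟨D2.mul_mem hf hg, ?_⟩
    rw [AffineEquiv.coe_mul, Function.comp_apply, aff_apply]
    exact add_mem (rot_mem_lattice hf hg0) hf0
  inv_mem' := by
    rintro f ⟨hf, hf0⟩
    have hl : (f⁻¹ : Aff).linear ∈ D2 := D2.inv_mem hf
    refine ⟨hl, ?_⟩
    have h0 : (f⁻¹ : Aff) (f 0) = 0 := f.symm_apply_apply 0
    rw [aff_apply] at h0
    rw [eq_neg_of_add_eq_zero_right h0]
    exact neg_mem (rot_mem_lattice hl hf0)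

/-- The rotational part `{R|v} ↦ R`, as a homomorphism from the site-symmetry group of `q` to
`D₂`. -/
def siteRot (a b c : ℝ) (q : R3) : siteGroup (G a b c) q →* D2 where
  toFun h := ⟨h.1.linear, h.2.1.1⟩
  map_one' := rfl
  map_mul' _ _ := rfl

theorem trans_mem {a b c : ℝ} {t : R3} (ht : t ∈ lattice a b c) : translation t ∈ G a b c := by
  refine ⟨?_, by simpa [translation] using ht⟩
  have : (translation t).linear = 1 := by ext v; simp [translation]
  rw [this]; exact D2.one_mem

/-- The orbital at a site `q` whose translates by the lattice are permuted by the space group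
(one site per primitive cell, so that the only representative is the identity), with the
one-dimensional representation of the site-symmetry group obtained from the representation `ρ` of
`D₂` through `siteRot`. -/
abbrev orbital (a b c : ℝ) (q : R3) (hq : ∀ h ∈ G a b c, h q - q ∈ lattice a b c)
    (ρ : D2 →* Matrix.unitaryGroup (Fin 1) ℂ) : Orbital (G a b c) where
  site := q
  dim := 1
  rep := ρ.comp (siteRot a b c q)
  sites := 1
  coset := fun _ => 1
  coset_mem := fun _ => (G a b c).one_mem
  coset_unique := by
    intro h hh
    have ht := trans_mem (hq h hh)
    refine ⟨0, ⟨h q - q, ht, (translation (h q - q))⁻¹ * h, ⟨?_, ?_⟩, ?_⟩, fun α _ => Subsingleton.elim _ _⟩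
    · exact (G a b c).mul_mem ((G a b c).inv_mem ht) hh
    · rw [AffineEquiv.coe_mul, Function.comp_apply, AffineEquiv.inv_def,
        AffineEquiv.symm_apply_eq]
      simp [translation]
    · simp

/-- The representative `q = (0, 0, 0)` of the Wyckoff position `4a`. -/
def site4a : R3 := 0

/-- The representative `q' = (0, 0, 1/2)` (in conventional coordinates) of the Wyckoff position
`4b`. -/
def site4b (c : ℝ) : R3 := ![0, 0, c / 2]

theorem site4a_perm (a b c : ℝ) : ∀ h ∈ G a b c, h site4a - site4a ∈ lattice a b c := by
  rintro h ⟨_, h0⟩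
  simpa [site4a] using h0

theorem site4b_perm (a b c : ℝ) : ∀ h ∈ G a b c, h (site4b c) - site4b c ∈ lattice a b c := by
  rintro h ⟨hl, h0⟩
  have key : h.linear (site4b c) - site4b c ∈ lattice a b c := by
    have htz := neg_mem (tz_mem a b c)
    rcases hl with hl | hl | hl | hl <;> rw [hl]
    · simp
    · convert htz using 1
      ext i; fin_cases i <;> simp [C2x_apply, site4b, tz, t1, t2, t3]; ring
    · convert htz using 1
      ext i; fin_cases i <;> simp [C2y_apply, site4b, tz, t1, t2, t3]; ring
    · convert (lattice a b c).zero_mem using 1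
      ext i; fin_cases i <;> simp [C2z_apply, site4b]
  rw [aff_apply, add_sub_right_comm]
  exact add_mem key h0

/-- The band representation `ρ ↑ G` induced from the `4a` site `q`. -/
def rho4a (a b c : ℝ) (ρ : D2 →* Matrix.unitaryGroup (Fin 1) ℂ) :
    BandFun (G a b c) (Fin 1 × Fin 1) :=
  (orbital a b c site4a (site4a_perm a b c) ρ).induced

/-- The band representation `ρ' ↑ G` induced from the `4b` site `q'`, where
`ρ'({C_{2,100(010)}|t_z}) = ρ(C_{2,100(010)})` and `ρ'({C_{2,001}|0}) = ρ(C_{2,001})`. -/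
def rho4b (a b c : ℝ) (ρ : D2 →* Matrix.unitaryGroup (Fin 1) ℂ) :
    BandFun (G a b c) (Fin 1 × Fin 1) :=
  (orbital a b c (site4b c) (site4b_perm a b c) ρ).induced

/-- The plane-wave gauge transformation `k ↦ e^{-i k · r}`. -/
def planeWave (r k : R3) : Matrix (Fin 1 × Fin 1) (Fin 1 × Fin 1) ℂ :=
  Complex.exp (-Complex.I * ((k ⬝ᵥ r : ℝ) : ℂ)) • 1

/-- The gauge transformation `M_k = e^{-i c k_z / 2}` (`e^{-i k_z / 2}` in units with `c = 1`). -/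
def M (c : ℝ) (k : R3) : Matrix (Fin 1 × Fin 1) (Fin 1 × Fin 1) ℂ :=
  Complex.exp (-Complex.I * ((c * k 2 / 2 : ℝ) : ℂ)) • 1

/-- The loop `ℓ`: the vectors `g₁`, `g₂`, `g₃` and `-g₁-g₂-g₃` put end-to-end. -/
def loop (a b c : ℝ) : Chain1 :=
  seg 0 (g1 a b c) + seg (g1 a b c) (g1 a b c + g2 a b c)
    + seg (g1 a b c + g2 a b c) (g1 a b c + g2 a b c + g3 a b c)
    + seg (g1 a b c + g2 a b c + g3 a b c) 0

/-- The boundary of the surface is the loop `ℓ`. -/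
def BoundsLoop (a b c : ℝ) (Sg : Chain2) : Prop :=
  boundary Sg - loop a b c ∈ trivialChains

/-- The class `n` modulo `4` is the invariant of the band:
`e^{2π i n / 4} = W_{g₁} e^{-(i/4) ∫_Σ Ω · dΣ}` for every surface `Σ` with boundary `ℓ`. -/
def IsBerryInvariant (a b c : ℝ) {H : Type*} [NormedAddCommGroup H] [InnerProductSpace ℂ H]
    (u : R3 → H) (n : ZMod 4) : Prop :=
  ∀ Sg : Chain2, BoundsLoop a b c Sg →
    Complex.exp (2 * Real.pi * Complex.I * (n.val : ℂ) / 4) =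
      wilson u (g1 a b c) *
        Complex.exp (-(Complex.I / 4) * ((flux (berryCurvature u) Sg : ℝ) : ℂ))

end F222

end

/-!
# Two inequivalent band representations of `F222` with the same irreps

The band representations induced from the `4a` site `0` and the `4b` site `q' = (0, 0, c/2)` differ
by the plane wave `e^{-i k · q'}`, and every difference between them comes from the fact that this
plane wave changes sign under the reciprocal lattice vectors `g₁, g₂, g₃`.

*Homotopies.* The blocks of any band representation are Brillouin-zone periodic, since the exponents
in an induced representation are lattice vectors (`IsBandRep.bzPeriodic`). Along a homotopy of
rank-one band representations the winding number of `k ↦ S^k({C_{2,100}|0})` from `0` to `g₁` is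
therefore constant. It is `0` for `4a` and `-1` for `4b` (`not_homotopicallyEquivalent_rho`). The
characters of little groups do not see this, because `R k - k` pairs with `q'` as with a lattice
vector when it is a reciprocal lattice vector (`irrepEquivalent_rho`).

*Gauge transformations.* A gauge transformation from `4a` to `4b` is the plane wave times a phase
`φ` invariant under `D₂`. If it were continuous and periodic, `φ` would be antiperiodic under all
`R g₁`, `R ∈ D₂`. By invariance its logarithm would grow by the same odd multiple of `π` along each
of these four vectors, whose sum is zero (`not_antiperiodic_of_invariant`).

*The Berry invariant.* The four edges of the loop are, up to reciprocal lattice translations, the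
vectors `R g₁` with `R ∈ D₂`. By Stokes' theorem (`flux_curl`) and periodicity of the Berry
connection, the flux through any surface bounded by the loop is `∑_R θ(R g₁)`, where `θ(K)` is the
real Berry phase along the segment from `0` to `K` (`flux_berryCurvature`). A symmetry of the band
changes the connection by the gradient of a phase (`berryConnection_dotProduct_of_map_eq`), which is
periodic, so `θ(R g₁) - θ(g₁) ∈ 2π ℤ` and the flux is `4 θ(g₁)` modulo `2π`; this gives the
invariant `n`. When the band is induced from a site `q`, in a gauge with phase `μ`, the quantity
`θ(K) - K · q - μ(K)` does not change under rotations of `K`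
(`berryPhase_rot_of_transformsExactly`). As `∑_R R g₁ = 0`, and as `μ` grows additively along
reciprocal lattice vectors, the flux is `4 θ(g₁) - 4 g₁ · q` modulo `8π`, whence `n = 0` for `q = 0`
and `n = 2` for `q = q'`, where `g₁ · q' = π`.
-/

noncomputable section

namespace BandRep

/-! ### Phases of functions of modulus one -/

section Phase

variable {E : Type*} [NormedAddCommGroup E] [NormedSpace ℝ E]

/-- A continuous function of modulus one on a normed space, being defined on a simply connected
space, has a continuous phase. -/
theorem exists_continuous_phase {z : E → ℂ} (hz : Continuous z) (h1 : ∀ x, ‖z x‖ = 1) :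
    ∃ α : E → ℝ, Continuous α ∧ ∀ x, z x = Complex.exp (Complex.I * (α x : ℂ)) := by
  have hU : IsSimplyConnected (Set.univ : Set E) := by
    have : ContractibleSpace (Set.univ : Set E) := (Homeomorph.Set.univ E).contractibleSpace
    exact SimplyConnectedSpace.ofContractible _
  obtain ⟨f, hf, he⟩ := Complex.exists_continuousOn_eqOn_exp_comp hU isOpen_univ
    hz.continuousOn (by
      rintro ⟨x, -, hx⟩
      have := h1 x
      simp [hx] at this)
  have he' : ∀ x, Complex.exp (f x) = z x := fun x => he (Set.mem_univ x)
  refine ⟨fun x => (f x).im, Complex.continuous_im.comp (by simpa using hf), fun x => ?_⟩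
  have hre : (f x).re = 0 := by
    have := h1 x
    rwa [← he', Complex.norm_exp, Real.exp_eq_one_iff] at this
  rw [← he']
  congr 1
  apply Complex.ext <;> simp [hre]

theorem exp_I_mul_eq_iff {x y : ℝ} :
    Complex.exp (Complex.I * (x : ℂ)) = Complex.exp (Complex.I * (y : ℂ)) ↔
      ∃ n : ℤ, x = y + 2 * Real.pi * n := by
  rw [Complex.exp_eq_exp_iff_exists_int]
  constructor
  · rintro ⟨n, hn⟩
    refine ⟨n, ?_⟩
    have := congrArg Complex.im hn
    simp at this
    linarith
  · rintro ⟨n, rfl⟩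
    exact ⟨n, by push_cast; ring⟩

/-- A continuous phase of a constant function is constant. -/
theorem eq_of_exp_I_mul_const {f : E → ℝ} (hf : Continuous f) {c : ℂ}
    (h : ∀ x, Complex.exp (Complex.I * (f x : ℂ)) = c) (x y : E) : f x = f y := by
  have hi : ∀ x, ∃ n : ℤ, f x = f y + 2 * Real.pi * n := fun x =>
    exp_I_mul_eq_iff.1 ((h x).trans (h y).symm)
  choose n hn using hi
  have hpi := Real.pi_pos
  have hn' : ∀ x, ((n x : ℤ) : ℝ) = (f x - f y) / (2 * Real.pi) := fun x => by
    rw [hn x]; field_simp; ring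
  have hc : Continuous n := by
    rw [Int.isClosedEmbedding_coe_real.isInducing.continuous_iff]
    have : (Int.cast ∘ n : E → ℝ) = fun x => (f x - f y) / (2 * Real.pi) := funext hn'
    rw [this]
    fun_prop
  have := PreconnectedSpace.constant (inferInstance : PreconnectedSpace E) hc (x := x) (y := y)
  have h0 := hn y
  rw [hn x, this]
  exact h0.symm

/-- A smooth function of modulus one on a normed space has a smooth phase: near each point, the
continuous phase differs by a constant from the principal argument of a quotient of values. -/
theorem exists_contDiff_phase {z : E → ℂ} (hz : ContDiff ℝ ∞ z) (h1 : ∀ x, ‖z x‖ = 1) :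
    ∃ α : E → ℝ, ContDiff ℝ ∞ α ∧ ∀ x, z x = Complex.exp (Complex.I * (α x : ℂ)) := by
  obtain ⟨α, hα, he⟩ := exists_continuous_phase hz.continuous h1
  refine ⟨α, contDiff_iff_contDiffAt.2 fun x₀ => ?_, he⟩
  have hz0 : z x₀ ≠ 0 := by
    intro h; have := h1 x₀; simp [h] at this
  have hlog : ContDiffAt ℝ ∞ (fun x => (Complex.log (z x / z x₀)).im) x₀ := by
    have h2 : ContDiffAt ℝ ∞ (fun x => z x / z x₀) x₀ := by
      simp only [div_eq_mul_inv]
      exact hz.contDiffAt.mul contDiffAt_const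
    have h3 : ContDiffAt ℝ ∞ Complex.log (z x₀ / z x₀) := by
      refine (Complex.contDiffAt_log (n := ∞) ?_).restrict_scalars ℝ
      rw [div_self hz0]; exact Complex.one_mem_slitPlane
    exact Complex.imCLM.contDiff.contDiffAt.comp x₀ (h3.comp x₀ h2)
  refine (hlog.add (contDiffAt_const (c := α x₀))).congr_of_eventuallyEq ?_
  have hev : ∀ᶠ x in nhds x₀, |α x - α x₀| < Real.pi := by
    have : Filter.Tendsto (fun x => |α x - α x₀|) (nhds x₀) (nhds |α x₀ - α x₀|) :=
      (hα.sub continuous_const).abs.tendsto x₀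
    rw [sub_self, abs_zero] at this
    exact this.eventually (gt_mem_nhds Real.pi_pos)
  filter_upwards [hev] with x hx
  rw [abs_lt] at hx
  have hq : z x / z x₀ = Complex.exp (((α x - α x₀ : ℝ) : ℂ) * Complex.I) := by
    rw [he x, he x₀, ← Complex.exp_sub]; congr 1; push_cast; ring
  rw [hq, Complex.log_exp (by simpa using hx.1) (by simpa using hx.2.le)]
  simp

end Phase

/-! ### Line integrals and Stokes' theorem for chains -/

theorem fderiv_dotProduct {E : Type*} [NormedAddCommGroup E] [NormedSpace ℝ E] {f g : E → R3}
    {x : E} (hf : DifferentiableAt ℝ f x) (hg : DifferentiableAt ℝ g x) (v : E) :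
    fderiv ℝ (fun y => f y ⬝ᵥ g y) x v = fderiv ℝ f x v ⬝ᵥ g x + f x ⬝ᵥ fderiv ℝ g x v := by
  have hf' := hasFDerivAt_pi'.1 hf.hasFDerivAt
  have hg' := hasFDerivAt_pi'.1 hg.hasFDerivAt
  have := HasFDerivAt.fun_sum (u := Finset.univ) fun i _ => (hf' i).mul (hg' i)
  have h2 : HasFDerivAt (fun y => f y ⬝ᵥ g y) _ x := this
  rw [h2.fderiv]
  simp only [dotProduct, sum_apply, add_apply,
    smul_apply, ContinuousLinearMap.comp_apply, ContinuousLinearMap.proj_apply,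
    smul_eq_mul, ← Finset.sum_add_distrib]
  exact Finset.sum_congr rfl fun i _ => by ring

theorem contDiff_dotProduct {E : Type*} [NormedAddCommGroup E] [NormedSpace ℝ E] {n : ℕ∞ω}
    {f g : E → R3} (hf : ContDiff ℝ n f) (hg : ContDiff ℝ n g) :
    ContDiff ℝ n fun y => f y ⬝ᵥ g y :=
  ContDiff.sum fun i _ => (contDiff_pi.1 hf i).mul (contDiff_pi.1 hg i)

theorem continuous_dotProduct {X : Type*} [TopologicalSpace X] {f g : X → R3}
    (hf : Continuous f) (hg : Continuous g) : Continuous fun y => f y ⬝ᵥ g y :=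
  continuous_finsetSum _ fun i _ =>
    ((continuous_apply i).comp hf).mul ((continuous_apply i).comp hg)

/-- The antisymmetric part of the Jacobian of a vector field is its curl. -/
theorem curl_dotProduct_cross (A : R3 → R3) (k v w : R3) :
    curl A k ⬝ᵥ crossProduct v w = fderiv ℝ A k v ⬝ᵥ w - fderiv ℝ A k w ⬝ᵥ v := by
  have key : ∀ v : R3, fderiv ℝ A k v = v 0 • fderiv ℝ A k (Pi.single 0 1)
      + v 1 • fderiv ℝ A k (Pi.single 1 1) + v 2 • fderiv ℝ A k (Pi.single 2 1) := fun v => by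
    rw [← map_smul, ← map_smul, ← map_smul, ← map_add, ← map_add]
    congr 1
    ext i; fin_cases i <;> simp
  rw [key v, key w]
  simp [curl, cross_apply, dotProduct, Fin.sum_univ_three]
  ring

/-- The line integral `∫ A · dl` along a path. Paths are maps of the closed unit interval, so they
are continued by constants to the real line; only the derivative at interior points matters. No
smoothness is required, which makes the integral a function on all chains. -/
def pathIntegral (A : R3 → R3) (γ : unitInterval → R3) : ℝ :=
  ∫ x in (0 : ℝ)..1,
    A (Set.IccExtend zero_le_one γ x) ⬝ᵥ deriv (Set.IccExtend zero_le_one γ) x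

/-- The line integral along a chain. -/
def chainIntegral (A : R3 → R3) : Chain1 →+ ℝ :=
  Finsupp.liftAddHom fun γ => zmultiplesHom ℝ (pathIntegral A γ)

theorem chainIntegral_single (A : R3 → R3) (γ : unitInterval → R3) :
    chainIntegral A (Finsupp.single γ 1) = pathIntegral A γ := by
  simp [chainIntegral]

/-- For a path given by a function on the real line, the line integral is the usual one. -/
theorem chainIntegral_path (A : R3 → R3) (γ : ℝ → R3) :
    chainIntegral A (path γ) = ∫ x in (0 : ℝ)..1, A (γ x) ⬝ᵥ deriv γ x := by
  rw [path, chainIntegral_single, pathIntegral]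
  refine intervalIntegral.integral_congr_Ioo_of_le zero_le_one fun x hx => ?_
  have h : ∀ y ∈ Set.Ioo (0 : ℝ) 1,
      Set.IccExtend zero_le_one (fun x : unitInterval => γ x) y = γ y := fun y hy => by
    rw [Set.IccExtend_of_mem _ _ (Set.Ioo_subset_Icc_self hy)]
  have he : Set.IccExtend zero_le_one (fun x : unitInterval => γ x) =ᶠ[nhds x] γ :=
    Filter.eventually_of_mem (isOpen_Ioo.mem_nhds hx) h
  simp only [he.deriv_eq, h x hx]

theorem chainIntegral_seg (A : R3 → R3) (p q : R3) :
    chainIntegral A (seg p q) = ∫ x in (0 : ℝ)..1, A (p + x • (q - p)) ⬝ᵥ (q - p) := by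
  rw [seg, chainIntegral_path]
  refine intervalIntegral.integral_congr fun x _ => ?_
  have : HasDerivAt (fun x : ℝ => p + x • (q - p)) ((1 : ℝ) • (q - p)) x :=
    ((hasDerivAt_id x).smul_const (q - p)).const_add p
  simp only [this.deriv, one_smul]

theorem pathIntegral_reverse (A : R3 → R3) (γ : unitInterval → R3) :
    pathIntegral A (fun x => γ (unitInterval.symm x)) = -pathIntegral A γ := by
  have h : Set.IccExtend zero_le_one (fun x => γ (unitInterval.symm x)) =
      fun x : ℝ => Set.IccExtend zero_le_one γ (1 - x) := by
    funext x
    simp only [Set.IccExtend, Function.comp_apply]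
    congr 1
    ext
    simp only [unitInterval.coe_symm_eq, Set.coe_projIcc]
    rcases le_total x 0 with h0 | h0 <;> rcases le_total x 1 with h1 | h1 <;> simp [h0, h1]
    linarith
  rw [pathIntegral, h]
  simp only [deriv_comp_const_sub, dotProduct_neg, intervalIntegral.integral_neg]
  rw [intervalIntegral.integral_comp_sub_left
    (fun x => A (Set.IccExtend zero_le_one γ x) ⬝ᵥ deriv (Set.IccExtend zero_le_one γ) x) 1]
  simp [pathIntegral]

theorem chainIntegral_eq_zero_of_mem_trivialChains (A : R3 → R3) {c : Chain1}
    (hc : c ∈ trivialChains) : chainIntegral A c = 0 := by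
  suffices trivialChains ≤ (chainIntegral A).ker from this hc
  refine (AddSubgroup.closure_le _).2 ?_
  rintro c (⟨p, rfl⟩ | ⟨γ, rfl⟩)
  · simp only [SetLike.mem_coe, AddMonoidHom.mem_ker, chainIntegral_single, pathIntegral]
    have : Set.IccExtend zero_le_one (fun _ : unitInterval => p) = fun _ : ℝ => p := rfl
    simp [this]
  · simp only [SetLike.mem_coe, AddMonoidHom.mem_ker, map_add, chainIntegral_single,
      pathIntegral_reverse, add_neg_cancel]

/-- Stokes' theorem for a smooth square. -/
theorem patchFlux_curl {A : R3 → R3} (hA : ContDiff ℝ ∞ A) (σ : Patch) :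
    patchFlux (curl A) σ = chainIntegral A (patchBoundary σ) := by
  obtain ⟨σ, hσ⟩ := σ
  have hσd : ∀ p, DifferentiableAt ℝ σ p := hσ.differentiable (by simp)
  have hAd : ∀ p, DifferentiableAt ℝ A p := hA.differentiable (by simp)
  have hD : ContDiff ℝ ∞ (fderiv ℝ σ) := hσ.fderiv_right (by simp)
  have hDv : ∀ v, ContDiff ℝ ∞ fun p => fderiv ℝ σ p v := fun v => hD.clm_apply contDiff_const
  have hAσ : ContDiff ℝ ∞ fun p => A (σ p) := hA.comp hσ
  -- the one-form `A · dσ` pulled back to the square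
  have hF : ∀ v, ContDiff ℝ ∞ fun p => A (σ p) ⬝ᵥ fderiv ℝ σ p v := fun v =>
    contDiff_dotProduct hAσ (hDv v)
  have hFd : ∀ v p w, fderiv ℝ (fun p => A (σ p) ⬝ᵥ fderiv ℝ σ p v) p w =
      fderiv ℝ A (σ p) (fderiv ℝ σ p w) ⬝ᵥ fderiv ℝ σ p v
        + A (σ p) ⬝ᵥ fderiv ℝ (fderiv ℝ σ) p w v := fun v p w => by
    rw [fderiv_dotProduct (hAσ.differentiable (by simp) p) ((hDv v).differentiable (by simp) p)]
    have e1 : fderiv ℝ (fun p => A (σ p)) p = (fderiv ℝ A (σ p)).comp (fderiv ℝ σ p) :=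
      fderiv_comp p (hAd _) (hσd p)
    have e2 : fderiv ℝ (fun p => fderiv ℝ σ p v) p w = fderiv ℝ (fderiv ℝ σ) p w v := by
      rw [fderiv_clm_apply (hD.differentiable (by simp) p) (by fun_prop)]
      simp
    rw [e1, e2]; rfl
  have hsymm : ∀ p v w, fderiv ℝ (fderiv ℝ σ) p v w = fderiv ℝ (fderiv ℝ σ) p w v := fun p v w =>
    (hσ.contDiffAt.isSymmSndFDerivAt (by simpa using ENat.LEInfty.out)) v w
  let f : ℝ × ℝ → ℝ := fun p => A (σ p) ⬝ᵥ fderiv ℝ σ p (0, 1)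
  let g : ℝ × ℝ → ℝ := fun p => -(A (σ p) ⬝ᵥ fderiv ℝ σ p (1, 0))
  have hf : ContDiff ℝ ∞ f := hF _
  have hg : ContDiff ℝ ∞ g := (hF _).neg
  have hfg : ∀ p, fderiv ℝ f p (1, 0) + fderiv ℝ g p (0, 1) =
      curl A (σ p) ⬝ᵥ crossProduct (fderiv ℝ σ p (1, 0)) (fderiv ℝ σ p (0, 1)) := fun p => by
    have : fderiv ℝ g p = -fderiv ℝ (fun p => A (σ p) ⬝ᵥ fderiv ℝ σ p (1, 0)) p := fderiv_neg
    rw [this, curl_dotProduct_cross, neg_apply, hFd, hFd, hsymm p (0, 1)]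
    ring
  have hS := integral2_divergence_prod_of_hasFDerivAt_off_countable f g (fderiv ℝ f) (fderiv ℝ g)
    0 0 1 1 ∅ Set.countable_empty hf.continuous.continuousOn hg.continuous.continuousOn
    (fun p _ => (hf.differentiable (by simp) p).hasFDerivAt)
    (fun p _ => (hg.differentiable (by simp) p).hasFDerivAt) (by
      refine ContinuousOn.integrableOn_compact (isCompact_uIcc.prod isCompact_uIcc) ?_
      exact (((hf.fderiv_right (m := ∞) (by simp)).clm_apply contDiff_const).add
        ((hg.fderiv_right (m := ∞) (by simp)).clm_apply contDiff_const)).continuous.continuousOn)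
  simp only [hfg] at hS
  have hs : ∀ s t : ℝ, deriv (fun s => σ (s, t)) s = fderiv ℝ σ (s, t) (1, 0) := fun s t =>
    ((hσd (s, t)).hasFDerivAt.comp_hasDerivAt s
      ((hasDerivAt_id s).prodMk (hasDerivAt_const s t))).deriv
  have ht : ∀ s t : ℝ, deriv (fun t => σ (s, t)) t = fderiv ℝ σ (s, t) (0, 1) := fun s t =>
    ((hσd (s, t)).hasFDerivAt.comp_hasDerivAt t
      ((hasDerivAt_const t s).prodMk (hasDerivAt_id t))).deriv
  simp only [patchFlux, patchBoundary, map_add, map_sub, chainIntegral_path, hs, ht]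
  rw [hS]
  simp only [f, g, intervalIntegral.integral_neg]
  ring

/-- Stokes' theorem for a surface. -/
theorem flux_curl {A : R3 → R3} (hA : ContDiff ℝ ∞ A) (Sg : Chain2) :
    flux (curl A) Sg = chainIntegral A (boundary Sg) := by
  rw [flux, boundary, map_finsuppSum]
  refine Finsupp.sum_congr fun σ _ => ?_
  rw [patchFlux_curl hA, map_zsmul, zsmul_eq_mul]

/-! ### Berry connections and Berry phases -/

section Berry

variable {H : Type*} [NormedAddCommGroup H] [InnerProductSpace ℂ H]

theorem berryConnection_dotProduct (u : R3 → H) (k v : R3) :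
    berryConnection u k ⬝ᵥ v = (Complex.I * inner ℂ (u k) (fderiv ℝ u k v)).re := by
  have hv : v = ∑ j, v j • Pi.single j (1 : ℝ) := by
    ext i; simp [Finset.sum_apply, Pi.single_apply]
  conv_rhs => rw [hv]
  rw [map_sum, inner_sum, Finset.mul_sum, Complex.re_sum]
  refine Finset.sum_congr rfl fun j _ => ?_
  rw [map_smul, inner_smul_right_eq_smul]
  simp [berryConnection]
  ring

theorem contDiff_berryConnection {u : R3 → H} (hu : ContDiff ℝ ∞ u) :
    ContDiff ℝ ∞ (berryConnection u) := by
  refine contDiff_pi.2 fun j => ?_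
  have h : ContDiff ℝ ∞ fun k => inner ℂ (u k) (fderiv ℝ u k (Pi.single j 1)) :=
    hu.inner ℂ ((hu.fderiv_right (m := ∞) (by simp)).clm_apply contDiff_const)
  exact Complex.reCLM.contDiff.comp (contDiff_const.mul h)

/-- Transformation of the Berry connection when an isometry carries the states `u k` to the states
`w (g k)` up to a phase: it is pulled back along `g` and shifted by the gradient of the phase. -/
theorem berryConnection_dotProduct_of_map_eq (T : H ≃ₗᵢ[ℂ] H) {u w : R3 → H} {α : R3 → ℝ}
    {g : R3 → R3} {k : R3} (hu : DifferentiableAt ℝ u k) (hw : DifferentiableAt ℝ w (g k))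
    (hw1 : ‖w (g k)‖ = 1) (hα : DifferentiableAt ℝ α k) (hg : DifferentiableAt ℝ g k)
    (h : ∀ k, T (u k) = Complex.exp (Complex.I * (α k : ℂ)) • w (g k)) (v : R3) :
    berryConnection u k ⬝ᵥ v =
      berryConnection w (g k) ⬝ᵥ fderiv ℝ g k v - fderiv ℝ α k v := by
  have hT : HasFDerivAt (fun k => T (u k)) _ k :=
    ((T : H →L[ℂ] H).restrictScalars ℝ).hasFDerivAt.comp k hu.hasFDerivAt
  have hα' : HasFDerivAt (fun k => (α k : ℂ)) (Complex.ofRealCLM.comp (fderiv ℝ α k)) k :=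
    Complex.ofRealCLM.hasFDerivAt.comp k hα.hasFDerivAt
  have hr := ((hα'.const_mul Complex.I).cexp).smul (hw.hasFDerivAt.comp k hg.hasFDerivAt)
  have h' : (fun k => T (u k)) = fun k => Complex.exp (Complex.I * (α k : ℂ)) • w (g k) :=
    funext h
  rw [h'] at hT
  have hD := DFunLike.congr_fun (hT.unique hr) v
  have hD' : T (fderiv ℝ u k v) =
      Complex.exp (Complex.I * (α k : ℂ)) •
        (fderiv ℝ w (g k) (fderiv ℝ g k v) + (Complex.I * (fderiv ℝ α k v : ℝ)) • w (g k)) := by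
    refine Eq.trans hD ?_
    simp [smul_smul, smul_add, mul_assoc]
  have he : ‖Complex.exp (Complex.I * (α k : ℂ))‖ = 1 := by
    rw [mul_comm]; exact Complex.norm_exp_ofReal_mul_I _
  rw [berryConnection_dotProduct, berryConnection_dotProduct, ← T.inner_map_map, h k, hD',
    inner_smul_left, inner_smul_right, ← mul_assoc, ← mul_assoc, mul_assoc Complex.I,
    ← Complex.normSq_eq_conj_mul_self, Complex.normSq_eq_norm_sq, he, inner_add_right,
    inner_smul_right, inner_self_eq_norm_sq_to_K, hw1]
  simp [mul_add, ← mul_assoc, sub_eq_add_neg]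

/-- The exponent `∫ A · dl` of the Berry phase along the segment from `0` to `K`, as a real
number. -/
def berryPhase (u : R3 → H) (K : R3) : ℝ :=
  ∫ x in (0 : ℝ)..1, berryConnection u (x • K) ⬝ᵥ K

theorem wilson_eq_exp_berryPhase (u : R3 → H) (K : R3) :
    wilson u K = Complex.exp (Complex.I * (berryPhase u K : ℂ)) := rfl

theorem berryPhase_of_map_eq (T : H ≃ₗᵢ[ℂ] H) {u w : R3 → H} {α : R3 → ℝ} {R : R3 →ₗ[ℝ] R3}
    (hu : ContDiff ℝ ∞ u) (hw : ContDiff ℝ ∞ w) (hw1 : ∀ k, ‖w k‖ = 1) (hα : ContDiff ℝ ∞ α)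
    (h : ∀ k, T (u k) = Complex.exp (Complex.I * (α k : ℂ)) • w (R k)) (K : R3) :
    berryPhase u K = berryPhase w (R K) - (α K - α 0) := by
  have hR : ∀ k, HasFDerivAt (fun k => R k) (LinearMap.toContinuousLinearMap R) k := fun k =>
    (LinearMap.toContinuousLinearMap R).hasFDerivAt
  have hdu := hu.differentiable (by simp)
  have hdw := hw.differentiable (by simp)
  have hdα := hα.differentiable (by simp)
  have hline : ∀ x : ℝ, HasDerivAt (fun x : ℝ => x • K) K x := fun x => by
    simpa using (hasDerivAt_id x).smul_const K
  have hderiv : ∀ x : ℝ, HasDerivAt (fun x : ℝ => α (x • K)) (fderiv ℝ α (x • K) K) x := fun x =>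
    (hdα (x • K)).hasFDerivAt.comp_hasDerivAt x (hline x)
  have hcα : Continuous fun x : ℝ => fderiv ℝ α (x • K) K :=
    ((hα.continuous_fderiv (by simp)).comp (by fun_prop)).clm_apply continuous_const
  have hcw : Continuous fun x : ℝ => berryConnection w (x • R K) ⬝ᵥ R K :=
    continuous_dotProduct ((contDiff_berryConnection hw).continuous.comp (by fun_prop))
      continuous_const
  have hFTC := intervalIntegral.integral_eq_sub_of_hasDerivAt (a := 0) (b := 1)
    (fun x _ => hderiv x) (hcα.intervalIntegrable _ _)
  rw [one_smul, zero_smul] at hFTC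
  rw [← hFTC, berryPhase, berryPhase, ← intervalIntegral.integral_sub
    (hcw.intervalIntegrable _ _) (hcα.intervalIntegrable _ _)]
  refine intervalIntegral.integral_congr fun x _ => ?_
  rw [berryConnection_dotProduct_of_map_eq T (hdu _) (hdw _) (hw1 _) (hdα _)
    (hR _).differentiableAt h, (hR _).fderiv]
  simp

variable {G : Subgroup Aff}

/-- The Berry connection of a band has the periodicity of the Brillouin zone. -/
theorem berryConnection_add_recip {X : BlochSpace G H} {u : R3 → H} (hu : IsBand X u)
    (K : recipLattice G) (k : R3) : berryConnection u (k + K) = berryConnection u k := by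
  obtain ⟨hs, h1, hp⟩ := hu
  refine dotProduct_eq _ _ fun v => ?_
  have hd := hs.differentiable (by simp)
  have h : ∀ k, (X.boost K).symm (u k) =
      Complex.exp (Complex.I * ((0 : ℝ) : ℂ)) • u (k + K) := fun k => by
    rw [LinearIsometryEquiv.symm_apply_eq]; simp [hp]
  rw [berryConnection_dotProduct_of_map_eq (X.boost K).symm (α := fun _ => 0)
    (g := fun k => k + (K : R3)) (hd k) (hd _) (h1 _) (by fun_prop) (by fun_prop) h v]
  simp

theorem chainIntegral_berryConnection_seg {X : BlochSpace G H} {u : R3 → H} (hu : IsBand X u)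
    {p q K : R3} (hp : p ∈ recipLattice G) (hK : q - p = K) :
    chainIntegral (berryConnection u) (seg p q) = berryPhase u K := by
  rw [chainIntegral_seg, berryPhase, hK]
  refine intervalIntegral.integral_congr fun x _ => ?_
  rw [add_comm, berryConnection_add_recip hu ⟨p, hp⟩]

theorem norm_exp_I_mul (x : ℝ) : ‖Complex.exp (Complex.I * (x : ℂ))‖ = 1 := by
  rw [mul_comm]; exact Complex.norm_exp_ofReal_mul_I x

/-- The phase of a Brillouin-zone periodic function of modulus one changes by an integer multiple
of `2π` under a reciprocal lattice translation, and the integer does not depend on the momentum. -/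
theorem exists_phase_add_recip {α : R3 → ℝ} (hα : Continuous α) {K : R3}
    (hK : ∀ k, Complex.exp (Complex.I * (α (k + K) : ℂ)) = Complex.exp (Complex.I * (α k : ℂ))) :
    ∃ n : ℤ, ∀ k, α (k + K) = α k + 2 * Real.pi * n := by
  obtain ⟨n, hn⟩ := exp_I_mul_eq_iff.1 (hK 0)
  refine ⟨n, fun k => ?_⟩
  have := eq_of_exp_I_mul_const (f := fun k => α (k + K) - α k) (c := 1) (by fun_prop)
    (fun k => by
      push_cast
      rw [mul_sub, Complex.exp_sub, hK, div_self (Complex.exp_ne_zero _)]) k 0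
  linarith

end Berry

/-! ### Band representations of a general space group -/

theorem dotProduct_exp_eq_one {G : Subgroup Aff} {K t : R3} (hK : K ∈ recipLattice G)
    (ht : t ∈ latticeOf G) : Complex.exp (-Complex.I * ((K ⬝ᵥ t : ℝ) : ℂ)) = 1 := by
  obtain ⟨n, hn⟩ := hK t ht
  rw [hn, Complex.exp_eq_one_iff]
  exact ⟨-n, by push_cast; ring⟩

/-- The blocks of an induced band representation have the periodicity of the Brillouin zone,
because the exponents `t_{βα}(h)` are lattice vectors wherever the block does not vanish. -/
theorem Orbital.induced_bzPeriodic {G : Subgroup Aff}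
    (hG : ∀ h ∈ G, ∀ K ∈ recipLattice G, h.linear K ∈ recipLattice G) (D : Orbital G) (h : G) :
    BZPeriodic G fun k => D.induced k h := by
  intro K hK k
  ext ⟨j, β⟩ ⟨i, α⟩
  simp only [induced]
  by_cases hm : (D.coset β)⁻¹ * translation (-D.shift h β α) * h * D.coset α
      ∈ siteGroup G D.site
  · have ht : D.shift h β α ∈ latticeOf G := by
      have h1 : translation (-D.shift h β α) ∈ G := by
        have := G.mul_mem (G.mul_mem (G.mul_mem (D.coset_mem β) hm.1)
          (G.inv_mem (D.coset_mem α))) (G.inv_mem h.2)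
        simpa [mul_assoc] using this
      exact neg_mem_iff.1 (show -D.shift h β α ∈ latticeOf G from h1)
    congr 1
    rw [map_add, add_dotProduct]
    push_cast
    rw [mul_add, Complex.exp_add, dotProduct_exp_eq_one (hG h h.2 K hK) ht, mul_one]
  · simp [repExt, hm]

theorem IsBandRep.bzPeriodic {G : Subgroup Aff}
    (hG : ∀ h ∈ G, ∀ K ∈ recipLattice G, h.linear K ∈ recipLattice G)
    {ι : Type} [Fintype ι] [DecidableEq ι] {S : BandFun G ι} (hS : IsBandRep G S) (h : G) :
    BZPeriodic G fun k => S k h := by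
  obtain ⟨r, D, e, U, -, -, hU, hR⟩ := hS
  intro K hK k
  have h1 : ∀ s, (D s).induced (k + K) h = (D s).induced k h := fun s =>
    (D s).induced_bzPeriodic hG h K hK k
  simp only [hR _ h, h1, map_add, hU K hK k, hU _ (hG h h.2 K hK)]

theorem Orbital.isBandRep_induced {G : Subgroup Aff} (D : Orbital G) :
    IsBandRep G D.induced := by
  refine ⟨1, fun _ => D, (Equiv.uniqueSigma fun _ : Fin 1 => Fin D.dim × Fin D.sites).symm,
    fun _ => 1, fun _ => one_mem _, fun i j => contDiff_const, fun _ _ _ => rfl, fun k h => ?_⟩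
  ext i j
  simp [Equiv.uniqueSigma, Matrix.blockDiagonal'_apply]

theorem isEBR_of_card_eq_one {G : Subgroup Aff} {ι : Type} [Fintype ι] [DecidableEq ι]
    {S : BandFun G ι} (hS : IsBandRep G S) (hι : Fintype.card ι = 1) : IsEBR S := by
  refine ⟨hS, ?_⟩
  rintro ⟨m, n, -, -, e, hm, hn, -⟩
  have := Fintype.card_congr e
  simp [hι] at this
  omega

theorem gaugeRelated_iff {G : Subgroup Aff} {N : R3 → Matrix (Fin 1 × Fin 1) (Fin 1 × Fin 1) ℂ}
    {S S' : BandFun G (Fin 1 × Fin 1)} :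
    GaugeRelated N S S' ↔ ∀ k (h : G), S' k h 0 0 =
      (starRingEnd ℂ) (N ((h : Aff).linear k) 0 0) * S k h 0 0 * N k 0 0 := by
  refine forall₂_congr fun k h => ?_
  rw [← Matrix.ext_iff]
  have hs : ∀ i : Fin 1 × Fin 1, i = 0 := fun i => Subsingleton.elim _ _
  constructor
  · intro H
    simpa [Matrix.mul_apply, hs] using H 0 0
  · intro H i j
    rw [hs i, hs j, H]
    simp [Matrix.mul_apply, hs]

theorem norm_eq_one_of_mem_unitaryGroup {ι : Type*} [Fintype ι] [DecidableEq ι] [Subsingleton ι]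
    {A : Matrix ι ι ℂ} (hA : A ∈ Matrix.unitaryGroup ι ℂ) (i : ι) : ‖A i i‖ = 1 := by
  have h := congrFun₂ (Matrix.mem_unitaryGroup_iff.1 hA) i i
  simp only [Matrix.mul_apply, Fintype.sum_subsingleton _ i, Matrix.star_apply,
    Matrix.one_apply_eq] at h
  rw [RCLike.star_def, Complex.mul_conj, Complex.normSq_eq_norm_sq] at h
  have h2 : ‖A i i‖ ^ 2 = 1 := by exact_mod_cast h
  nlinarith [norm_nonneg (A i i)]

end BandRep

namespace F222

open BandRep

/-! ### The point group `D₂` and the lattices of `F222` -/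

theorem rot_dotProduct {R : R3 ≃ₗ[ℝ] R3} (hR : R ∈ D2) (k v : R3) :
    R k ⬝ᵥ v = k ⬝ᵥ R v := by
  rcases hR with rfl | rfl | rfl | rfl <;>
    simp [C2x_apply, C2y_apply, C2z_apply, dotProduct, Fin.sum_univ_three]

theorem rot_rot {R : R3 ≃ₗ[ℝ] R3} (hR : R ∈ D2) (v : R3) : R (R v) = v := by
  rcases hR with rfl | rfl | rfl | rfl <;> ext i <;> fin_cases i <;>
    simp [C2x_apply, C2y_apply, C2z_apply]

theorem rot_dotProduct_rot {R : R3 ≃ₗ[ℝ] R3} (hR : R ∈ D2) (k v : R3) :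
    R k ⬝ᵥ R v = k ⬝ᵥ v := by rw [rot_dotProduct hR, rot_rot hR]

theorem C2x_mem : C2x ∈ D2 := Or.inr (Or.inl rfl)
theorem C2y_mem : C2y ∈ D2 := Or.inr (Or.inr (Or.inl rfl))
theorem C2z_mem : C2z ∈ D2 := Or.inr (Or.inr (Or.inr rfl))

theorem sum_rot (v : R3) : v + C2x v + C2y v + C2z v = 0 := by
  ext i; fin_cases i <;> simp [C2x_apply, C2y_apply, C2z_apply, Matrix.vecHead, Matrix.vecTail]

theorem C2z_g1 (a b c : ℝ) : C2z (g1 a b c) = g2 a b c := by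
  ext i; fin_cases i <;> simp [C2z_apply, g1, g2]
theorem C2y_g1 (a b c : ℝ) : C2y (g1 a b c) = g3 a b c := by
  ext i; fin_cases i <;> simp [C2y_apply, g1, g3]

theorem C2x_g1 (a b c : ℝ) : C2x (g1 a b c) = -(g1 a b c + g2 a b c + g3 a b c) := by
  have := sum_rot (g1 a b c)
  rw [C2z_g1, C2y_g1] at this
  linear_combination (exp := 1) this

/-- Irreducible representations of `D₂` are one-dimensional: each `σ R` is an involution commuting
with the representation, so its fixed space is everything or zero, and `σ R = ±1`. -/
theorem finrank_eq_one_of_isIrreducible (V : Type*) [AddCommGroup V] [Module ℂ V]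
    (σ : Representation ℂ D2 V) (hσ : σ.IsIrreducible) : Module.finrank ℂ V = 1 := by
  have hsq : ∀ R : D2, R * R = 1 := fun R => Subtype.ext (LinearEquiv.ext (rot_rot R.2))
  have hcomm : ∀ R S : D2, R * S = S * R := fun R S => by
    have hinv : ∀ R : D2, R⁻¹ = R := fun R => inv_eq_of_mul_eq_one_left (hsq R)
    rw [← hinv (R * S), mul_inv_rev, hinv, hinv]
  have hσσ : ∀ (R : D2) v, σ R (σ R v) = v := fun R v => by
    rw [← Module.End.mul_apply, ← map_mul, hsq, map_one, Module.End.one_apply]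
  have hpm : ∀ R : D2, (∀ v, σ R v = v) ∨ (∀ v, σ R v = -v) := fun R => by
    let W : Subrepresentation σ :=
      { toSubmodule := LinearMap.ker (σ R - 1)
        apply_mem_toSubmodule := fun S v hv => by
          simp only [LinearMap.mem_ker, LinearMap.sub_apply, Module.End.one_apply, sub_eq_zero]
            at hv ⊢
          rw [← Module.End.mul_apply, ← map_mul, hcomm, map_mul, Module.End.mul_apply, hv] }
    have hW : ∀ v, v ∈ W ↔ σ R v = v := fun v => by
      change v ∈ LinearMap.ker (σ R - 1) ↔ _
      simp [sub_eq_zero]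
    rcases eq_bot_or_eq_top W with h | h
    · refine Or.inr fun v => ?_
      have h1 : v + σ R v ∈ W := by rw [hW, map_add, hσσ, add_comm]
      rw [h] at h1
      exact eq_neg_of_add_eq_zero_right h1
    · exact Or.inl fun v => (hW v).1 (h ▸ Submodule.mem_top)
  have hnt : Nontrivial V := by
    by_contra hn
    rw [not_nontrivial_iff_subsingleton] at hn
    obtain ⟨W, W', hWW⟩ := hσ.toNontrivial
    refine hWW (SetLike.ext fun v => ?_)
    rw [Subsingleton.elim v 0]
    exact iff_of_true W.toSubmodule.zero_mem W'.toSubmodule.zero_mem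
  obtain ⟨v, hv⟩ := exists_ne (0 : V)
  let W : Subrepresentation σ :=
    { toSubmodule := Submodule.span ℂ {v}
      apply_mem_toSubmodule := fun R w hw => by
        rcases hpm R with h | h <;> rw [h]
        · exact hw
        · exact neg_mem hw }
  have hW : W = ⊤ := (eq_bot_or_eq_top W).resolve_left fun h =>
    hv (by
      have : v ∈ W := Submodule.mem_span_singleton_self v
      rw [h] at this
      exact this)
  refine (finrank_eq_one_iff_of_nonzero' v hv).2 fun w => Submodule.mem_span_singleton.1 ?_
  have : w ∈ W := hW ▸ Submodule.mem_top
  exact this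

theorem mem_latticeOf {a b c : ℝ} {t : R3} : t ∈ latticeOf (G a b c) ↔ t ∈ lattice a b c :=
  ⟨fun h => by simpa [translation] using h.2, trans_mem⟩

theorem mem_recipLattice_of {a b c : ℝ} {K : R3} (h1 : ∃ n : ℤ, K ⬝ᵥ t1 a b c = 2 * Real.pi * n)
    (h2 : ∃ n : ℤ, K ⬝ᵥ t2 a b c = 2 * Real.pi * n)
    (h3 : ∃ n : ℤ, K ⬝ᵥ t3 a b c = 2 * Real.pi * n) : K ∈ recipLattice (G a b c) := by
  intro t ht
  rw [mem_latticeOf] at ht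
  induction ht using AddSubgroup.closure_induction with
  | zero => exact ⟨0, by simp⟩
  | add x y _ _ hx hy =>
    obtain ⟨m, hm⟩ := hx
    obtain ⟨n, hn⟩ := hy
    exact ⟨m + n, by rw [dotProduct_add, hm, hn]; push_cast; ring⟩
  | neg x _ hx =>
    obtain ⟨m, hm⟩ := hx
    exact ⟨-m, by rw [dotProduct_neg, hm]; push_cast; ring⟩
  | mem x hx => rcases hx with rfl | rfl | rfl <;> assumption

theorem rot_mem_recipLattice {a b c : ℝ} {R : R3 ≃ₗ[ℝ] R3} (hR : R ∈ D2) {K : R3}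
    (hK : K ∈ recipLattice (G a b c)) : R K ∈ recipLattice (G a b c) := by
  intro t ht
  rw [rot_dotProduct hR]
  exact hK _ (mem_latticeOf.2 (rot_mem_lattice hR (mem_latticeOf.1 ht)))

theorem linear_mem_recipLattice {a b c : ℝ} :
    ∀ h ∈ G a b c, ∀ K ∈ recipLattice (G a b c), h.linear K ∈ recipLattice (G a b c) :=
  fun _ hh _ hK => rot_mem_recipLattice hh.1 hK

theorem g1_mem {a b c : ℝ} (ha : a ≠ 0) (hb : b ≠ 0) (hc : c ≠ 0) :
    g1 a b c ∈ recipLattice (G a b c) := by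
  refine mem_recipLattice_of ⟨1, ?_⟩ ⟨0, ?_⟩ ⟨0, ?_⟩ <;>
    simp [g1, t1, t2, t3, dotProduct, Fin.sum_univ_three] <;> field_simp <;> ring

/-! ### The two induced band representations -/

/-- The element `{R|0}` of `F222`. -/
def pointElt (a b c : ℝ) (R : D2) : G a b c :=
  ⟨(R : R3 ≃ₗ[ℝ] R3).toAffineEquiv, R.2, by
    change (R : R3 ≃ₗ[ℝ] R3) 0 ∈ _
    rw [map_zero]; exact zero_mem _⟩

theorem pointElt_linear (a b c : ℝ) (R : D2) : (pointElt a b c R : Aff).linear = R := rfl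

theorem pointElt_zero (a b c : ℝ) (R : D2) : (pointElt a b c R : Aff) 0 = 0 :=
  map_zero (R : R3 ≃ₗ[ℝ] R3)

theorem translation_mul_linear (t : R3) (h : Aff) : (translation t * h).linear = h.linear := by
  change (translation t).linear * h.linear = h.linear
  have : (translation t).linear = 1 := by ext v; simp [translation]
  rw [this, one_mul]

theorem siteRot_bijective (a b c : ℝ) (q : R3) (hq : ∀ h ∈ G a b c, h q - q ∈ lattice a b c) :
    Function.Bijective (siteRot a b c q) := by
  constructor
  · rintro ⟨g, hg, hgq⟩ ⟨h, hh, hhq⟩ e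
    have hl : g.linear = h.linear := congrArg Subtype.val e
    refine Subtype.ext (AffineEquiv.ext fun r => ?_)
    have h1 := aff_apply g q
    have h2 := aff_apply h q
    have h0 : g 0 = h 0 := by
      rw [hgq] at h1; rw [hhq] at h2
      exact add_left_cancel (h1.symm.trans (h2.trans (by rw [hl])))
    rw [aff_apply g, aff_apply h, hl, h0]
  · intro R
    have hR := (pointElt a b c R).2
    refine ⟨⟨translation (-((pointElt a b c R : Aff) q - q)) * (pointElt a b c R : Aff),
      mul_mem (trans_mem (neg_mem (hq _ hR))) hR, ?_⟩, ?_⟩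
    · simp [translation]
    · exact Subtype.ext (translation_mul_linear _ _)

theorem orbital_induced_apply (a b c : ℝ) (q : R3)
    (hq : ∀ h ∈ G a b c, h q - q ∈ lattice a b c) (ρ : D2 →* Matrix.unitaryGroup (Fin 1) ℂ)
    (k : R3) (h : G a b c) (i j : Fin 1 × Fin 1) :
    (orbital a b c q hq ρ).induced k h i j =
      Complex.exp (-Complex.I * (((h : Aff).linear k ⬝ᵥ ((h : Aff) q - q) : ℝ) : ℂ)) *
        (ρ ⟨(h : Aff).linear, h.2.1⟩).1 i.1 j.1 := by
  have hm : (1 : Aff)⁻¹ * translation (-((h : Aff) q - q)) * h * 1 ∈ siteGroup (G a b c) q := by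
    refine ⟨?_, by simp [translation]⟩
    simpa using mul_mem (trans_mem (neg_mem (hq _ h.2))) h.2
  have hl : siteRot a b c q ⟨_, hm⟩ = ⟨(h : Aff).linear, h.2.1⟩ := by
    refine Subtype.ext ?_
    change ((1 : Aff)⁻¹ * translation (-((h : Aff) q - q)) * h * 1).linear = _
    rw [inv_one, one_mul, mul_one, translation_mul_linear]
  rw [← hl]
  simp only [Orbital.induced, Orbital.shift, Orbital.repExt]
  erw [dif_pos hm]
  rfl

theorem rot_site4b {c : ℝ} (a b : ℝ) {R : R3 ≃ₗ[ℝ] R3} :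
    (R = 1 ∨ R = C2z → R (site4b c) - site4b c = 0) ∧
      (R = C2x ∨ R = C2y → R (site4b c) - site4b c = -tz a b c) := by
  constructor
  · rintro (rfl | rfl)
    · simp
    · ext i; fin_cases i <;> simp [C2z_apply, site4b]
  · rintro (rfl | rfl) <;> ext i <;> fin_cases i <;>
      simp [C2x_apply, C2y_apply, site4b, tz, t1, t2, t3] <;> ring

theorem aff_site_sub (h : Aff) (q : R3) : h q - q = h 0 + (h.linear q - q) := by
  rw [aff_apply h q]; abel

theorem dotProduct_site4b (c : ℝ) (k : R3) : k ⬝ᵥ site4b c = c * k 2 / 2 := by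
  simp [site4b, dotProduct, Fin.sum_univ_three]; ring

theorem M_apply (c : ℝ) (k : R3) :
    M c k 0 0 = Complex.exp (-Complex.I * ((k ⬝ᵥ site4b c : ℝ) : ℂ)) := by
  rw [dotProduct_site4b]
  simp [M]

theorem planeWave_apply (r k : R3) :
    planeWave r k 0 0 = Complex.exp (-Complex.I * ((k ⬝ᵥ r : ℝ) : ℂ)) := by
  simp [planeWave]

theorem M_eq_planeWave (c : ℝ) : M c = planeWave (site4b c) := by
  funext k
  rw [M, planeWave, dotProduct_site4b]

theorem planeWave_mem_unitaryGroup (r k : R3) :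
    planeWave r k ∈ Matrix.unitaryGroup (Fin 1 × Fin 1) ℂ := by
  rw [Matrix.mem_unitaryGroup_iff, planeWave, star_smul, star_one, Matrix.smul_mul,
    Matrix.one_mul, smul_smul, RCLike.star_def, ← Complex.exp_conj, ← Complex.exp_add]
  simp

/-! ### Irrep-equivalence, gauge transformations and homotopies -/

section Gauge

variable {a b c : ℝ} {ρ : D2 →* Matrix.unitaryGroup (Fin 1) ℂ}

theorem rho4a_apply (k : R3) (h : G a b c) (i j : Fin 1 × Fin 1) :
    rho4a a b c ρ k h i j =
      Complex.exp (-Complex.I * (((h : Aff).linear k ⬝ᵥ (h : Aff) 0 : ℝ) : ℂ)) *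
        (ρ ⟨(h : Aff).linear, h.2.1⟩).1 i.1 j.1 := by
  rw [rho4a, orbital_induced_apply, site4a, sub_zero]

theorem rho4a_pointElt (k : R3) (R : D2) (i j : Fin 1 × Fin 1) :
    rho4a a b c ρ k (pointElt a b c R) i j = (ρ R).1 i.1 j.1 := by
  have h0 : (pointElt a b c R : Aff).linear k ⬝ᵥ (pointElt a b c R : Aff) 0 = 0 := by
    rw [pointElt_zero, dotProduct_zero]
  rw [rho4a_apply, h0]
  simp [pointElt_linear]

theorem rho4b_apply (k : R3) (h : G a b c) (i j : Fin 1 × Fin 1) :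
    rho4b a b c ρ k h i j =
      Complex.exp (-Complex.I * (((h : Aff).linear k ⬝ᵥ
        ((h : Aff) 0 + ((h : Aff).linear (site4b c) - site4b c)) : ℝ) : ℂ)) *
        (ρ ⟨(h : Aff).linear, h.2.1⟩).1 i.1 j.1 := by
  rw [rho4b, orbital_induced_apply, aff_site_sub]

/-- The two band representations differ by the phase `e^{i ((R k) · q' - k · q')}`, which is the
effect of the plane wave centred at the `4b` site `q'`. -/
theorem rho4b_eq_mul_rho4a (k : R3) (h : G a b c) (i j : Fin 1 × Fin 1) :
    rho4b a b c ρ k h i j =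
      Complex.exp (Complex.I * (((h : Aff).linear k ⬝ᵥ site4b c - k ⬝ᵥ site4b c : ℝ) : ℂ)) *
        rho4a a b c ρ k h i j := by
  rw [rho4b_apply, rho4a_apply, ← mul_assoc, ← Complex.exp_add, dotProduct_add, dotProduct_sub,
    rot_dotProduct_rot h.2.1]
  congr 2
  push_cast
  ring

theorem rho4a_ne_zero (k : R3) (h : G a b c) : rho4a a b c ρ k h 0 0 ≠ 0 := by
  rw [rho4a_apply]
  refine mul_ne_zero (Complex.exp_ne_zero _) fun h0 => ?_
  have := norm_eq_one_of_mem_unitaryGroup (ρ ⟨(h : Aff).linear, h.2.1⟩).2 (0 : Fin 1)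
  exact zero_ne_one ((norm_zero (E := ℂ)).symm.trans ((congrArg norm h0).symm.trans this))

theorem gaugeRelated_rho_iff {N : R3 → Matrix (Fin 1 × Fin 1) (Fin 1 × Fin 1) ℂ} :
    GaugeRelated N (rho4a a b c ρ) (rho4b a b c ρ) ↔ ∀ R ∈ D2, ∀ k,
      (starRingEnd ℂ) (N (R k) 0 0) * N k 0 0 =
        Complex.exp (Complex.I * ((R k ⬝ᵥ site4b c - k ⬝ᵥ site4b c : ℝ) : ℂ)) := by
  rw [gaugeRelated_iff]
  have key : ∀ k (h : G a b c), (rho4b a b c ρ k h 0 0 =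
      (starRingEnd ℂ) (N ((h : Aff).linear k) 0 0) * rho4a a b c ρ k h 0 0 * N k 0 0) ↔
      (starRingEnd ℂ) (N ((h : Aff).linear k) 0 0) * N k 0 0 = Complex.exp (Complex.I *
        (((h : Aff).linear k ⬝ᵥ site4b c - k ⬝ᵥ site4b c : ℝ) : ℂ)) := fun k h => by
    rw [rho4b_eq_mul_rho4a, mul_right_comm, mul_left_inj' (rho4a_ne_zero k h), eq_comm]
  constructor
  · intro H R hR k
    exact (key k (pointElt a b c ⟨R, hR⟩)).1 (H k _)
  · intro H k h
    exact (key k h).2 (H _ h.2.1 k)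

/-- The gauge transformations from `4a` to `4b` are those that differ from the plane wave centred at
the `4b` site by a phase invariant under `D₂`. -/
theorem gaugeRelated_rho_iff_invariant {N : R3 → Matrix (Fin 1 × Fin 1) (Fin 1 × Fin 1) ℂ}
    (hN : ∀ k, N k ∈ Matrix.unitaryGroup (Fin 1 × Fin 1) ℂ) :
    GaugeRelated N (rho4a a b c ρ) (rho4b a b c ρ) ↔ ∀ R ∈ D2, ∀ k,
      N (R k) 0 0 * Complex.exp (Complex.I * ((R k ⬝ᵥ site4b c : ℝ) : ℂ)) =
        N k 0 0 * Complex.exp (Complex.I * ((k ⬝ᵥ site4b c : ℝ) : ℂ)) := by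
  rw [gaugeRelated_rho_iff]
  refine forall₂_congr fun R _ => forall_congr' fun k => ?_
  have h1 : N (R k) 0 0 * (starRingEnd ℂ) (N (R k) 0 0) = 1 := by
    rw [Complex.mul_conj, Complex.normSq_eq_norm_sq,
      norm_eq_one_of_mem_unitaryGroup (hN (R k)) 0]
    simp
  have h0 : N (R k) 0 0 ≠ 0 := left_ne_zero_of_mul_eq_one h1
  have he := Complex.exp_ne_zero (Complex.I * ((k ⬝ᵥ site4b c : ℝ) : ℂ))
  push_cast
  rw [mul_sub, Complex.exp_sub, eq_div_iff he, ← mul_right_inj' h0, ← mul_assoc, ← mul_assoc, h1,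
    one_mul, eq_comm]

theorem gaugeRelated_rho_iff_exists {N : R3 → Matrix (Fin 1 × Fin 1) (Fin 1 × Fin 1) ℂ}
    (hN : ∀ k, N k ∈ Matrix.unitaryGroup (Fin 1 × Fin 1) ℂ) :
    GaugeRelated N (rho4a a b c ρ) (rho4b a b c ρ) ↔
      ∃ φ : R3 → ℂ, (∀ k, ‖φ k‖ = 1) ∧ (∀ R ∈ D2, ∀ k, φ (R k) = φ k) ∧
        ∀ k, N k = φ k • F222.M c k := by
  rw [gaugeRelated_rho_iff_invariant hN]
  have hee : ∀ x : ℝ, Complex.exp (Complex.I * (x : ℂ)) * Complex.exp (-Complex.I * (x : ℂ)) = 1 :=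
    fun x => by rw [← Complex.exp_add]; simp
  constructor
  · intro H
    refine ⟨fun k => N k 0 0 * Complex.exp (Complex.I * ((k ⬝ᵥ site4b c : ℝ) : ℂ)),
      fun k => ?_, H, fun k => ?_⟩
    · rw [norm_mul, norm_eq_one_of_mem_unitaryGroup (hN k), norm_exp_I_mul, one_mul]
    · ext i j
      rw [Subsingleton.elim i 0, Subsingleton.elim j 0, Matrix.smul_apply, M_apply, smul_eq_mul,
        mul_assoc, hee, mul_one]
  · rintro ⟨φ, -, hφ, hNφ⟩ R hR k
    have : ∀ k, N k 0 0 * Complex.exp (Complex.I * ((k ⬝ᵥ site4b c : ℝ) : ℂ)) = φ k := fun k => by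
      rw [hNφ, Matrix.smul_apply, M_apply, smul_eq_mul, mul_assoc, mul_comm (Complex.exp _), hee,
        mul_one]
    rw [this, this, hφ R hR]

theorem gaugeRelated_planeWave_iff (r : R3) :
    GaugeRelated (planeWave r) (rho4a a b c ρ) (rho4b a b c ρ) ↔ r = site4b c := by
  rw [gaugeRelated_rho_iff_invariant (planeWave_mem_unitaryGroup r)]
  have hP : ∀ k, planeWave r k 0 0 * Complex.exp (Complex.I * ((k ⬝ᵥ site4b c : ℝ) : ℂ)) =
      Complex.exp (Complex.I * ((k ⬝ᵥ (site4b c - r) : ℝ) : ℂ)) := fun k => by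
    rw [planeWave_apply, ← Complex.exp_add, dotProduct_sub]
    congr 1; push_cast; ring
  simp only [hP]
  constructor
  · intro H
    set s := site4b c - r with hs
    have hR : ∀ R ∈ D2, ∀ k, R k ⬝ᵥ s = k ⬝ᵥ s := fun R hR k => by
      have := eq_of_exp_I_mul_const (f := fun k : R3 => R k ⬝ᵥ s - k ⬝ᵥ s) (c := 1)
        ((continuous_dotProduct (LinearMap.continuous_of_finiteDimensional (R : R3 →ₗ[ℝ] R3))
          continuous_const).sub (continuous_dotProduct continuous_id continuous_const))
        (fun k => by
          push_cast
          rw [mul_sub, Complex.exp_sub, H R hR, div_self (Complex.exp_ne_zero _)]) k 0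
      simpa [sub_eq_zero] using this
    have hx := hR C2x C2x_mem
    have hy := hR C2y C2y_mem
    have hs0 : s = 0 := by
      ext i
      fin_cases i
      · have := hy (Pi.single 0 1)
        simp [C2y_apply, dotProduct, Fin.sum_univ_three] at this
        simp; linarith
      · have := hx (Pi.single 1 1)
        simp [C2x_apply, dotProduct, Fin.sum_univ_three] at this
        simp; linarith
      · have := hx (Pi.single 2 1)
        simp [C2x_apply, dotProduct, Fin.sum_univ_three] at this
        simp; linarith
    exact (sub_eq_zero.1 hs0).symm
  · rintro rfl R _ k
    simp

theorem irrepEquivalent_rho : IrrepEquivalent (rho4a a b c ρ) (rho4b a b c ρ) := by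
  intro k h hk
  have hexp : Complex.exp (Complex.I *
      (((h : Aff).linear k ⬝ᵥ site4b c - k ⬝ᵥ site4b c : ℝ) : ℂ)) = 1 := by
    have hk' : (h : Aff).linear k - k ∈ recipLattice (G a b c) := hk
    obtain ⟨m, hm⟩ := hk' _ (mem_latticeOf.2 (t1_mem a b c))
    obtain ⟨n, hn⟩ := hk' _ (mem_latticeOf.2 (t2_mem a b c))
    rw [← sub_dotProduct, Complex.exp_eq_one_iff]
    -- for a rotation about the `x` axis, `R k - k` has no `x` component and pairs with `q'` as
    -- with the lattice vector `t₂`; for the `y` axis, as with `t₁`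
    have hz : ∃ l : ℤ, ((h : Aff).linear k - k) ⬝ᵥ site4b c = 2 * Real.pi * l := by
      rcases h.2.1 with hl | hl | hl | hl
      · exact ⟨0, by simp [hl]⟩
      · refine ⟨n, hn ▸ ?_⟩
        simp [hl, C2x_apply, site4b, t2, dotProduct, Fin.sum_univ_three]
      · refine ⟨m, hm ▸ ?_⟩
        simp [hl, C2y_apply, site4b, t1, dotProduct, Fin.sum_univ_three]
      · rw [Set.mem_singleton_iff] at hl
        exact ⟨0, by simp [hl, C2z_apply, site4b, dotProduct, Fin.sum_univ_three]⟩
    obtain ⟨l, hl⟩ := hz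
    exact ⟨l, by rw [hl]; push_cast; ring⟩
  simp only [Matrix.trace, Matrix.diag_apply, rho4b_eq_mul_rho4a k h, hexp, one_mul]

theorem recip_dotProduct_site4b (hc : c ≠ 0) :
    g1 a b c ⬝ᵥ site4b c = Real.pi ∧ g2 a b c ⬝ᵥ site4b c = Real.pi ∧
      g3 a b c ⬝ᵥ site4b c = -Real.pi := by
  refine ⟨?_, ?_, ?_⟩ <;> rw [dotProduct_site4b] <;> simp [g1, g2, g3] <;> field_simp

theorem M_add_recip (hc : c ≠ 0) (k : R3) :
    F222.M c (k + g1 a b c) = -F222.M c k ∧ F222.M c (k + g2 a b c) = -F222.M c k ∧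
      F222.M c (k + g3 a b c) = -F222.M c k := by
  obtain ⟨h1, h2, h3⟩ := recip_dotProduct_site4b (a := a) (b := b) hc
  have hπ : Complex.exp (-Complex.I * (Real.pi : ℂ)) = -1 := by
    rw [neg_mul, Complex.exp_neg, mul_comm, Complex.exp_pi_mul_I]; norm_num
  have hπ' : Complex.exp (-Complex.I * ((-Real.pi : ℝ) : ℂ)) = -1 := by
    rw [← Complex.exp_pi_mul_I]; congr 1; push_cast; ring
  refine ⟨?_, ?_, ?_⟩ <;> ext i j <;>
    rw [Subsingleton.elim i 0, Subsingleton.elim j 0, Matrix.neg_apply, M_apply, M_apply,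
      add_dotProduct, Complex.ofReal_add, mul_add, Complex.exp_add]
  · rw [h1, hπ, mul_neg_one]
  · rw [h2, hπ, mul_neg_one]
  · rw [h3, hπ', mul_neg_one]

theorem not_bzPeriodic_M (ha : a ≠ 0) (hb : b ≠ 0) (hc : c ≠ 0) :
    ¬ BZPeriodic (F222.G a b c) (F222.M c) := by
  intro H
  have h := (H _ (g1_mem ha hb hc) 0).symm.trans (M_add_recip (a := a) (b := b) hc 0).1
  have h0 := congrFun₂ h 0 0
  rw [Matrix.neg_apply, self_eq_neg, M_apply] at h0
  exact Complex.exp_ne_zero _ h0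

/-- No continuous function of modulus one is both invariant under `D₂` and antiperiodic under `g₁`:
its phase would grow by the same odd multiple of `π` along each of the four vectors `R g₁`, whose
sum is zero. -/
theorem not_antiperiodic_of_invariant {φ : R3 → ℂ} (hφ : Continuous φ) (h1 : ∀ k, ‖φ k‖ = 1)
    (hR : ∀ R ∈ D2, ∀ k, φ (R k) = φ k) (hg : ∀ k, φ (k + g1 a b c) = -φ k) : False := by
  obtain ⟨θ, hθ, he⟩ := exists_continuous_phase hφ h1
  have hφ0 : ∀ k, φ k ≠ 0 := fun k h => by simpa [h] using h1 k
  have hshift : ∀ R ∈ D2, ∀ k, φ (k + R (g1 a b c)) = -φ k := fun R hRm k => by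
    rw [← hR R hRm (k + R (g1 a b c)), map_add, rot_rot hRm, hg, hR R hRm]
  have hθR : ∀ R ∈ D2, ∀ k, θ (R k) = θ k := fun R hRm k => by
    have := eq_of_exp_I_mul_const (f := fun k : R3 => θ (R k) - θ k) (c := 1)
      ((hθ.comp (LinearMap.continuous_of_finiteDimensional (R : R3 →ₗ[ℝ] R3))).sub hθ)
      (fun k => by
        push_cast
        rw [mul_sub, Complex.exp_sub, ← he, ← he, hR R hRm, div_self (hφ0 k)]) k 0
    simpa [sub_eq_zero] using this
  have hexp : ∀ R ∈ D2, ∀ k,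
      Complex.exp (Complex.I * ((θ (k + R (g1 a b c)) - θ k : ℝ) : ℂ)) = -1 := fun R hRm k => by
    push_cast
    rw [mul_sub, Complex.exp_sub, ← he, ← he, hshift R hRm, neg_div, div_self (hφ0 k)]
  have hd : ∀ R ∈ D2, ∀ k, θ (k + R (g1 a b c)) = θ k + (θ (g1 a b c) - θ 0) := fun R hRm k => by
    have := eq_of_exp_I_mul_const (f := fun k : R3 => θ (k + R (g1 a b c)) - θ k)
      (by fun_prop) (hexp R hRm) k 0
    rw [zero_add, hθR R hRm] at this
    linarith
  have h0 := hd C2z C2z_mem (g1 a b c + C2x (g1 a b c) + C2y (g1 a b c))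
  rw [sum_rot, hd C2y C2y_mem, hd C2x C2x_mem] at h0
  have hz : θ (g1 a b c) - θ 0 = 0 := by linarith
  have := hexp 1 D2.one_mem 0
  rw [zero_add, LinearEquiv.coe_one, id, hz] at this
  norm_num at this

theorem not_exists_continuous_bzPeriodic (ha : a ≠ 0) (hb : b ≠ 0) (hc : c ≠ 0) :
    ¬ ∃ N : R3 → Matrix (Fin 1 × Fin 1) (Fin 1 × Fin 1) ℂ,
        (∀ k, N k ∈ Matrix.unitaryGroup (Fin 1 × Fin 1) ℂ) ∧ Continuous N ∧
        BZPeriodic (F222.G a b c) N ∧ GaugeRelated N (rho4a a b c ρ) (rho4b a b c ρ) := by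
  rintro ⟨N, hN, hNc, hNp, hNg⟩
  rw [gaugeRelated_rho_iff_invariant hN] at hNg
  refine not_antiperiodic_of_invariant (a := a) (b := b) (c := c)
    (φ := fun k => N k 0 0 * Complex.exp (Complex.I * ((k ⬝ᵥ site4b c : ℝ) : ℂ))) ?_ ?_ hNg ?_
  · refine (hNc.matrix_elem 0 0).mul (Complex.continuous_exp.comp (continuous_const.mul
      (Complex.continuous_ofReal.comp (continuous_dotProduct continuous_id continuous_const))))
  · intro k
    rw [norm_mul, norm_eq_one_of_mem_unitaryGroup (hN k), norm_exp_I_mul, one_mul]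
  · intro k
    rw [hNp _ (g1_mem ha hb hc), add_dotProduct, (recip_dotProduct_site4b hc).1,
      Complex.ofReal_add, mul_add, Complex.exp_add, mul_comm Complex.I (Real.pi : ℂ),
      Complex.exp_pi_mul_I]
    ring

/-- Along a homotopy of rank-one band representations the phase of the periodic function
`k ↦ S^k({C_{2,100}|0})` has a constant increment along `g₁`. The increment is `0` for `4a` and
`-2π` for `4b`. -/
theorem not_homotopicallyEquivalent_rho (ha : a ≠ 0) (hb : b ≠ 0) (hc : c ≠ 0) :
    ¬ HomotopicallyEquivalent (rho4a a b c ρ) (rho4b a b c ρ) := by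
  rintro ⟨F, hB, hU, -, hF, h0, h1⟩
  let h : F222.G a b c := pointElt a b c ⟨C2x, C2x_mem⟩
  let z : ℝ × R3 → ℂ := fun p => F (Set.projIcc 0 1 zero_le_one p.1) p.2 h 0 0
  have hproj : Continuous (Set.projIcc (0 : ℝ) 1 zero_le_one) := continuous_projIcc
  have hz : Continuous z := (hF h 0 0).comp
    ((hproj.comp continuous_fst).prodMk continuous_snd)
  obtain ⟨α, hα, he⟩ := exists_continuous_phase hz fun p =>
    norm_eq_one_of_mem_unitaryGroup (hU _ _ _) 0
  have hz0 : ∀ p, z p ≠ 0 := fun p => by rw [he]; exact Complex.exp_ne_zero _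
  have hper : ∀ τ, z (τ, g1 a b c) = z (τ, 0) := fun τ => by
    have := (hB (Set.projIcc 0 1 zero_le_one τ)).bzPeriodic linear_mem_recipLattice h
      (g1 a b c) (g1_mem ha hb hc) 0
    rw [zero_add] at this
    exact congrFun₂ this 0 0
  have hconst := eq_of_exp_I_mul_const (f := fun τ : ℝ => α (τ, g1 a b c) - α (τ, 0)) (c := 1)
    (by fun_prop) (fun τ => by
      push_cast
      rw [mul_sub, Complex.exp_sub, ← he, ← he, hper, div_self (hz0 _)]) 0 1
  have hza : ∀ k, z (0, k) = (ρ ⟨C2x, C2x_mem⟩).1 0 0 := fun k => by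
    change F (Set.projIcc 0 1 zero_le_one 0) k h 0 0 = _
    rw [Set.projIcc_left, show F ⟨0, _⟩ = rho4a a b c ρ from h0, rho4a_pointElt]
    rfl
  have hzb : ∀ k, z (1, k) =
      Complex.exp (-Complex.I * ((c * k 2 : ℝ) : ℂ)) * (ρ ⟨C2x, C2x_mem⟩).1 0 0 := fun k => by
    rw [← hza k]
    change F (Set.projIcc 0 1 zero_le_one 1) k h 0 0 =
      _ * F (Set.projIcc 0 1 zero_le_one 0) k h 0 0
    rw [Set.projIcc_left, Set.projIcc_right, show F ⟨0, _⟩ = rho4a a b c ρ from h0,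
      show F ⟨1, _⟩ = rho4b a b c ρ from h1, rho4b_eq_mul_rho4a, pointElt_linear,
      dotProduct_site4b, dotProduct_site4b, C2x_apply]
    congr 2
    simp
    ring
  have ha0 := eq_of_exp_I_mul_const (f := fun k : R3 => α (0, k)) (by fun_prop)
    (fun k => by rw [← he, hza]) (g1 a b c) 0
  have hb0 := eq_of_exp_I_mul_const (f := fun k : R3 => α (1, k) + c * k 2) (by fun_prop)
    (fun k => by
      push_cast
      rw [mul_add, Complex.exp_add, ← he, hzb, mul_right_comm, ← Complex.exp_add]
      push_cast
      rw [neg_mul, neg_add_cancel, Complex.exp_zero, one_mul]) (g1 a b c) 0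
  have hg : c * g1 a b c 2 = 2 * Real.pi := by simp [g1]; field_simp
  simp only [hg, Pi.zero_apply, mul_zero, add_zero] at hb0
  have := Real.pi_pos
  linarith

end Gauge
/-! ### The Berry invariant -/

section Invariant

variable {a b c : ℝ} {H : Type*} [NormedAddCommGroup H] [InnerProductSpace ℂ H]

/-- The flux of the Berry curvature through a surface bounded by the loop is the sum of the Berry
phases along the four edges, which are the vectors `R g₁` with `R ∈ D₂`. -/
theorem flux_berryCurvature (ha : a ≠ 0) (hb : b ≠ 0) (hc : c ≠ 0)
    {X : BlochSpace (F222.G a b c) H} {u : R3 → H} (hu : IsBand X u) {Sg : Chain2}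
    (hS : BoundsLoop a b c Sg) :
    flux (berryCurvature u) Sg = berryPhase u (g1 a b c) + berryPhase u (C2x (g1 a b c)) +
      berryPhase u (C2y (g1 a b c)) + berryPhase u (C2z (g1 a b c)) := by
  have h0 := chainIntegral_eq_zero_of_mem_trivialChains (berryConnection u) hS
  have m1 := g1_mem ha hb hc
  have m2 : g2 a b c ∈ recipLattice (F222.G a b c) := C2z_g1 a b c ▸ rot_mem_recipLattice C2z_mem m1
  have m3 : g3 a b c ∈ recipLattice (F222.G a b c) := C2y_g1 a b c ▸ rot_mem_recipLattice C2y_mem m1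
  rw [map_sub, sub_eq_zero] at h0
  rw [berryCurvature, flux_curl (contDiff_berryConnection hu.1), h0, loop, map_add, map_add,
    map_add, C2x_g1, C2y_g1, C2z_g1,
    chainIntegral_berryConnection_seg hu (zero_mem _) (sub_zero (g1 a b c)),
    chainIntegral_berryConnection_seg hu m1 (add_sub_cancel_left _ (g2 a b c)),
    chainIntegral_berryConnection_seg hu (add_mem m1 m2) (add_sub_cancel_left _ (g3 a b c)),
    chainIntegral_berryConnection_seg hu (add_mem (add_mem m1 m2) m3) (zero_sub _)]
  ring

/-- If the four Berry phases add up to `4 θ - 2π l`, where `θ` is the first of them, then the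
invariant is `l` modulo `4`. -/
theorem isBerryInvariant_of_sum_eq (ha : a ≠ 0) (hb : b ≠ 0) (hc : c ≠ 0)
    {X : BlochSpace (F222.G a b c) H} {u : R3 → H} (hu : IsBand X u) {l : ℤ}
    (hl : berryPhase u (g1 a b c) + berryPhase u (C2x (g1 a b c)) + berryPhase u (C2y (g1 a b c)) +
      berryPhase u (C2z (g1 a b c)) = 4 * berryPhase u (g1 a b c) - 2 * Real.pi * l) :
    IsBerryInvariant a b c u (l : ZMod 4) := by
  intro Sg hS
  have hz := (ZMod.toCircle_apply (l : ZMod 4)).symm.trans (ZMod.toCircle_intCast l)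
  rw [flux_berryCurvature ha hb hc hu hS, hl, wilson_eq_exp_berryPhase, ← Complex.exp_add]
  refine Eq.trans hz ?_
  congr 1
  push_cast
  ring

/-- A triangle, as a square with one side collapsed to the vertex `p`. -/
def triangle (p q r : R3) : Patch :=
  ⟨fun x => p + x.1 • (q - p) + (x.1 * x.2) • (r - q), by fun_prop⟩

theorem patchBoundary_triangle (p q r : R3) :
    patchBoundary (triangle p q r) = seg p q + seg q r - seg p r - path (fun _ => p) := by
  have h : ∀ s : ℝ, p + s • (q - p) + s • (r - q) = p + s • (r - p) := fun s => by
    rw [add_assoc, ← smul_add, sub_add_sub_cancel']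
  simp only [patchBoundary, triangle, seg, mul_zero, zero_smul, add_zero, mul_one, one_smul,
    one_mul, zero_mul, add_sub_cancel, h]

theorem boundary_single (σ : Patch) : boundary (Finsupp.single σ 1) = patchBoundary σ := by
  simp [boundary]

theorem boundary_add (S T : Chain2) : boundary (S + T) = boundary S + boundary T :=
  Finsupp.sum_add_index' (fun _ => zero_smul _ _) (fun _ _ _ => add_smul _ _ _)

theorem exists_boundsLoop (a b c : ℝ) : ∃ Sg, BoundsLoop a b c Sg := by
  set p := g1 a b c
  set q := g1 a b c + g2 a b c
  set r := g1 a b c + g2 a b c + g3 a b c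
  refine ⟨Finsupp.single (triangle 0 p q) 1 + Finsupp.single (triangle 0 q r) 1, ?_⟩
  rw [BoundsLoop, boundary_add, boundary_single, boundary_single, patchBoundary_triangle,
    patchBoundary_triangle]
  have h0 : path (fun _ => (0 : R3)) ∈ trivialChains :=
    AddSubgroup.subset_closure (Or.inl ⟨0, rfl⟩)
  have h1 : seg 0 r + seg r 0 ∈ trivialChains := by
    refine AddSubgroup.subset_closure (Or.inr ⟨fun x => 0 + (x : ℝ) • (r - 0), ?_⟩)
    simp only [seg, path]
    congr 2
    funext x
    simp only [unitInterval.coe_symm_eq, sub_smul, one_smul, sub_zero, zero_sub, smul_neg, zero_add]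
    abel
  convert neg_mem (add_mem h1 (add_mem h0 h0)) using 1
  simp only [loop]
  abel

theorem isBerryInvariant_unique {u : R3 → H} {m n : ZMod 4} (hm : IsBerryInvariant a b c u m)
    (hn : IsBerryInvariant a b c u n) : m = n := by
  obtain ⟨Sg, hS⟩ := exists_boundsLoop a b c
  have h := (hm Sg hS).trans (hn Sg hS).symm
  refine ZMod.injective_toCircle (Subtype.ext ?_)
  refine (ZMod.toCircle_apply m).trans (Eq.trans ?_ (ZMod.toCircle_apply n).symm)
  exact_mod_cast h

/-- In a symmetric band the Berry phases along `K` and `R K` agree modulo `2π`: the phase with which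
`{R|0}` acts has the periodicity of the Brillouin zone. -/
theorem exists_berryPhase_rot {X : BlochSpace (F222.G a b c) H} {u : R3 → H}
    (hu : IsSymmetricBand X u) {R : R3 ≃ₗ[ℝ] R3} (hR : R ∈ D2) {K : R3}
    (hK : K ∈ recipLattice (F222.G a b c)) :
    ∃ m : ℤ, berryPhase u (R K) = berryPhase u K + 2 * Real.pi * m := by
  obtain ⟨⟨hs, h1, hp⟩, hsym⟩ := hu
  let h := pointElt a b c ⟨R, hR⟩
  have hRs : ContDiff ℝ ∞ fun k => R k :=
    (LinearMap.toContinuousLinearMap (R : R3 →ₗ[ℝ] R3)).contDiff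
  let z : R3 → ℂ := fun k => inner ℂ (u (R k)) (X.sym h (u k))
  have hz : ∀ k, X.sym h (u k) = z k • u (R k) := fun k => by
    obtain ⟨w, hw⟩ := hsym h k
    have hw' : X.sym h (u k) = w • u (R k) := hw
    have : z k = w := by
      simp only [z]
      rw [hw', inner_smul_right, inner_self_eq_norm_sq_to_K, h1]; simp
    rw [this, hw']
  have hz1 : ∀ k, ‖z k‖ = 1 := fun k => by
    have := congrArg norm (hz k)
    rwa [LinearIsometryEquiv.norm_map, norm_smul, h1, h1, mul_one, eq_comm] at this
  have hzs : ContDiff ℝ ∞ z :=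
    (hs.comp hRs).inner ℂ ((((X.sym h : H →L[ℂ] H).restrictScalars ℝ).contDiff).comp hs)
  obtain ⟨α, hα, he⟩ := exists_contDiff_phase hzs hz1
  have hB := berryPhase_of_map_eq (X.sym h) (R := (R : R3 →ₗ[ℝ] R3)) hs hs h1 hα
    (fun k => by rw [hz, he]; rfl) K
  have hzK : z K = z 0 := by
    have hRK := rot_mem_recipLattice hR hK
    have e1 := hp ⟨K, hK⟩ 0
    have e2 := hp ⟨R K, hRK⟩ 0
    have e3 := X.sym_boost h ⟨K, hK⟩ ⟨R K, hRK⟩ rfl (u (0 + K))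
    rw [e1, pointElt_zero, hz, hz (0 + K)] at e3
    simp only [dotProduct_zero, Complex.ofReal_zero, mul_zero, Complex.exp_zero, one_smul,
      map_smul, zero_add, map_zero] at e3 e2
    rw [e2] at e3
    have h0 : u 0 ≠ 0 := fun h => by simpa [h] using h1 0
    exact (smul_left_injective ℂ h0 e3).symm
  rw [he, he] at hzK
  obtain ⟨m, hm⟩ := exp_I_mul_eq_iff.1 hzK
  refine ⟨m, ?_⟩
  have hB' : berryPhase u K = berryPhase u (R K) - (α K - α 0) := hB
  linarith

theorem existsUnique_isBerryInvariant (ha : a ≠ 0) (hb : b ≠ 0) (hc : c ≠ 0)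
    {X : BlochSpace (F222.G a b c) H} {u : R3 → H} (hu : IsSymmetricBand X u) :
    ∃! n : ZMod 4, IsBerryInvariant a b c u n := by
  have m1 := g1_mem ha hb hc
  obtain ⟨x, hx⟩ := exists_berryPhase_rot hu C2x_mem m1
  obtain ⟨y, hy⟩ := exists_berryPhase_rot hu C2y_mem m1
  obtain ⟨z, hz⟩ := exists_berryPhase_rot hu C2z_mem m1
  refine ⟨((-(x + y + z) : ℤ) : ZMod 4), isBerryInvariant_of_sum_eq ha hb hc hu.1 ?_,
    fun n hn => isBerryInvariant_unique hn (isBerryInvariant_of_sum_eq ha hb hc hu.1 ?_)⟩ <;>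
  · rw [hx, hy, hz]; push_cast; ring

end Invariant

/-! ### Bands transforming as an induced representation -/

section Induced

variable {a b c : ℝ} {H : Type*} [NormedAddCommGroup H] [InnerProductSpace ℂ H]
  {ρ : D2 →* Matrix.unitaryGroup (Fin 1) ℂ}

theorem orbital_induced_pointElt (q : R3) (hq : ∀ h ∈ F222.G a b c, h q - q ∈ lattice a b c)
    (k : R3) (R : D2) :
    (orbital a b c q hq ρ).induced k (pointElt a b c R) 0 0 =
      Complex.exp (Complex.I * (((R : R3 ≃ₗ[ℝ] R3) k ⬝ᵥ q - k ⬝ᵥ q : ℝ) : ℂ)) *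
        (ρ R).1 0 0 := by
  have h0 : (pointElt a b c R : Aff).linear k ⬝ᵥ ((pointElt a b c R : Aff) q - q) =
      -((R : R3 ≃ₗ[ℝ] R3) k ⬝ᵥ q - k ⬝ᵥ q) := by
    change (R : R3 ≃ₗ[ℝ] R3) k ⬝ᵥ ((R : R3 ≃ₗ[ℝ] R3) q - q) = _
    rw [dotProduct_sub, rot_dotProduct_rot R.2]; ring
  rw [orbital_induced_apply, h0, Complex.ofReal_neg, neg_mul_neg]
  rfl

theorem isSymmetricBand_of_transformsAs {X : BlochSpace (F222.G a b c) H} {u : R3 → H}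
    {S : BandFun (F222.G a b c) (Fin 1 × Fin 1)} (hT : TransformsAs X S u) :
    IsSymmetricBand X u := by
  obtain ⟨hu, M, -, hM1, -, hM⟩ := hT
  refine ⟨hu, fun h k => ?_⟩
  have hM0 : M k ≠ 0 := fun h => by simpa [h] using hM1 k
  have := hM h k
  rw [map_smul, smul_smul, smul_smul] at this
  exact ⟨_, ((eq_inv_smul_iff₀ (mul_ne_zero (Complex.exp_ne_zero _) hM0)).2 this).trans
    (smul_smul _ _ _)⟩

/-- For a band induced from the site `q`, in a gauge with phase `μ`, the Berry phase along `K` minus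
`K · q + μ K` is the same for all rotations of `K`. -/
theorem berryPhase_rot_of_transformsExactly {q : R3}
    {hq : ∀ h ∈ F222.G a b c, h q - q ∈ lattice a b c} {X : BlochSpace (F222.G a b c) H}
    {u : R3 → H} {μ : R3 → ℝ} (hs : ContDiff ℝ ∞ u) (h1 : ∀ k, ‖u k‖ = 1) (hμ : ContDiff ℝ ∞ μ)
    (hT : TransformsExactly X (orbital a b c q hq ρ).induced
      fun k => Complex.exp (Complex.I * (μ k : ℂ)) • u k)
    {R : R3 ≃ₗ[ℝ] R3} (hR : R ∈ D2) (K : R3) :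
    berryPhase u (R K) = berryPhase u K + (R K ⬝ᵥ q + μ (R K)) - (K ⬝ᵥ q + μ K) := by
  let h := pointElt a b c ⟨R, hR⟩
  have hRs : ContDiff ℝ ∞ fun k => R k :=
    (LinearMap.toContinuousLinearMap (R : R3 →ₗ[ℝ] R3)).contDiff
  obtain ⟨x, hx⟩ : ∃ x : ℝ, (ρ ⟨R, hR⟩).1 0 0 = Complex.exp (Complex.I * (x : ℂ)) := by
    refine ⟨((ρ ⟨R, hR⟩).1 0 0).arg, ?_⟩
    have := Complex.norm_mul_exp_arg_mul_I ((ρ ⟨R, hR⟩).1 0 0)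
    rw [norm_eq_one_of_mem_unitaryGroup (ρ ⟨R, hR⟩).2 (0 : Fin 1), Complex.ofReal_one, one_mul,
      mul_comm] at this
    exact this.symm
  let β : R3 → ℝ := fun k => R k ⬝ᵥ q - k ⬝ᵥ q + x + μ (R k) - μ k
  have hβ : ContDiff ℝ ∞ β :=
    ((((contDiff_dotProduct hRs contDiff_const).sub (contDiff_dotProduct contDiff_id
      contDiff_const)).add contDiff_const).add (hμ.comp hRs)).sub hμ
  have hact : ∀ k, X.sym h (u k) = Complex.exp (Complex.I * (β k : ℂ)) • u (R k) := fun k => by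
    have e := hT h k
    have e0 : (h : Aff).linear k ⬝ᵥ (h : Aff) 0 = 0 := by rw [pointElt_zero, dotProduct_zero]
    have e1 := orbital_induced_pointElt (ρ := ρ) q hq k ⟨R, hR⟩
    rw [e0] at e
    simp only [Complex.ofReal_zero, mul_zero, Complex.exp_zero, one_smul, map_smul] at e
    replace e : Complex.exp (Complex.I * (μ k : ℂ)) • X.sym h (u k) =
        (orbital a b c q hq ρ).induced k h 0 0 •
          Complex.exp (Complex.I * (μ (R k) : ℂ)) • u (R k) := e
    refine smul_right_injective H (Complex.exp_ne_zero (Complex.I * (μ k : ℂ))) (e.trans ?_)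
    simp only
    rw [e1, hx, smul_smul, smul_smul, ← Complex.exp_add, ← Complex.exp_add, ← Complex.exp_add]
    congr 2
    simp only [β]
    push_cast
    ring
  have hB : berryPhase u K = berryPhase u (R K) - (β K - β 0) :=
    berryPhase_of_map_eq (X.sym h) (R := (R : R3 →ₗ[ℝ] R3)) hs hs h1 hβ hact K
  simp only [β, map_zero, zero_dotProduct] at hB
  linarith

theorem isBerryInvariant_of_transformsAs (ha : a ≠ 0) (hb : b ≠ 0) (hc : c ≠ 0) {q : R3}
    {hq : ∀ h ∈ F222.G a b c, h q - q ∈ lattice a b c} {X : BlochSpace (F222.G a b c) H}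
    {u : R3 → H} (hT : TransformsAs X (orbital a b c q hq ρ).induced u) {l : ℤ}
    (hl : 4 * (g1 a b c ⬝ᵥ q) = 2 * Real.pi * l) : IsBerryInvariant a b c u (l : ZMod 4) := by
  obtain ⟨hu, M, hM, hM1, hMp, hT⟩ := hT
  obtain ⟨μ, hμ, hMμ⟩ := exists_contDiff_phase hM hM1
  obtain rfl : M = fun k => Complex.exp (Complex.I * (μ k : ℂ)) := funext hMμ
  have hrot := fun {R} (hR : R ∈ D2) =>
    berryPhase_rot_of_transformsExactly hu.1 hu.2.1 hμ hT hR (g1 a b c)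
  have m1 := g1_mem ha hb hc
  have hstep := fun {K} (hK : K ∈ recipLattice (F222.G a b c)) =>
    exists_phase_add_recip hμ.continuous (K := K) (hMp K hK)
  obtain ⟨n, hn⟩ := hstep m1
  obtain ⟨x, hx⟩ := hstep (rot_mem_recipLattice C2x_mem m1)
  obtain ⟨y, hy⟩ := hstep (rot_mem_recipLattice C2y_mem m1)
  obtain ⟨z, hz⟩ := hstep (rot_mem_recipLattice C2z_mem m1)
  -- the phase `μ` returns to its value at the origin along the closed chain of the four edges
  have hsum := hz (g1 a b c + C2x (g1 a b c) + C2y (g1 a b c))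
  rw [sum_rot, hy, hx] at hsum
  have hq0 : g1 a b c ⬝ᵥ q + C2x (g1 a b c) ⬝ᵥ q + C2y (g1 a b c) ⬝ᵥ q +
      C2z (g1 a b c) ⬝ᵥ q = 0 := by
    rw [← add_dotProduct, ← add_dotProduct, ← add_dotProduct, sum_rot, zero_dotProduct]
  have hn0 := hn 0
  have hx0 := hx 0
  have hy0 := hy 0
  have hz0 := hz 0
  rw [zero_add] at hn0 hx0 hy0 hz0
  have h4 : ((l + 4 * n : ℤ) : ZMod 4) = l := by
    push_cast
    rw [show (4 : ZMod 4) = 0 from rfl, zero_mul, add_zero]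
  rw [← h4]
  refine isBerryInvariant_of_sum_eq ha hb hc hu ?_
  rw [hrot C2x_mem, hrot C2y_mem, hrot C2z_mem]
  push_cast
  linarith

end Induced
/-! ### Bands with a single orbital per cell -/

section SingleOrbital

variable {a b c : ℝ} (ρ : D2 →* Matrix.unitaryGroup (Fin 1) ℂ)

/-- Multiplication by a complex number of modulus one, as an isometry of `ℂ`. -/
def phaseIsometry : Circle →* (ℂ ≃ₗᵢ[ℂ] ℂ) where
  toFun w :=
    { LinearEquiv.smulOfNeZero ℂ ℂ (w : ℂ) w.coe_ne_zero with
      norm_map' := fun z => by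
        change ‖(w : ℂ) • z‖ = ‖z‖
        rw [norm_smul, Circle.norm_coe, one_mul] }
  map_one' := by
    ext z
    change ((1 : Circle) : ℂ) • z = z
    simp
  map_mul' v w := by
    ext z
    change ((v * w : Circle) : ℂ) • z = (v : ℂ) • (w : ℂ) • z
    simp [mul_assoc]

theorem phaseIsometry_apply (w : Circle) (z : ℂ) : phaseIsometry w z = w * z := rfl

/-- The character of `D₂` given by the entry of a one-dimensional unitary representation. -/
def character : D2 →* Circle where
  toFun R := ⟨(ρ R).1 0 0, mem_sphere_zero_iff_norm.2
    (norm_eq_one_of_mem_unitaryGroup (ρ R).2 (0 : Fin 1))⟩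
  map_one' := by ext; simp
  map_mul' R S := by ext; simp [Matrix.mul_apply]; rfl

/-- The rotational part `{R|v} ↦ R`, as a homomorphism from the space group to `D₂`. -/
def rotHom (a b c : ℝ) : F222.G a b c →* D2 where
  toFun h := ⟨(h : Aff).linear, h.2.1⟩
  map_one' := rfl
  map_mul' _ _ := rfl

/-- The crystal whose space of cell-periodic functions is spanned by one orbital, located at `q` and
transforming by `ρ` under the site-symmetry group. -/
def singleOrbital (q : R3) (hq : ∀ h ∈ F222.G a b c, h q - q ∈ lattice a b c) :
    BlochSpace (F222.G a b c) ℂ where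
  boost K := phaseIsometry (Circle.exp ((K : R3) ⬝ᵥ q))
  sym := (phaseIsometry.comp (character ρ)).comp (rotHom a b c)
  boost_add K K' x := by
    simp only [phaseIsometry_apply, AddSubgroup.coe_add, add_dotProduct, Circle.exp_add,
      Circle.coe_mul, mul_assoc]
  sym_trans h hh := by
    have : rotHom a b c h = 1 := Subtype.ext hh
    simp [this]
  sym_boost h K K' hK x := by
    have hlat := dotProduct_exp_eq_one K'.2 (mem_latticeOf.2 (hq h h.2))
    have hKq : (K : R3) ⬝ᵥ q = (K' : R3) ⬝ᵥ (h : Aff).linear q := by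
      rw [hK]; exact (rot_dotProduct_rot h.2.1 _ _).symm
    simp only [MonoidHom.comp_apply, phaseIsometry_apply, smul_eq_mul, Circle.coe_exp]
    have he : Complex.exp (((K : R3) ⬝ᵥ q : ℝ) * Complex.I) =
        Complex.exp (-Complex.I * (((K' : R3) ⬝ᵥ (h : Aff) 0 : ℝ) : ℂ)) *
          Complex.exp (((K' : R3) ⬝ᵥ q : ℝ) * Complex.I) := by
      rw [← mul_one (Complex.exp (((K : R3) ⬝ᵥ q : ℝ) * Complex.I)), ← hlat, hKq, aff_site_sub,
        dotProduct_add, dotProduct_sub, ← Complex.exp_add, ← Complex.exp_add]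
      congr 1
      push_cast
      ring
    rw [he]
    ring

/-- The Bloch functions `e^{-i k · q}` of a single orbital at `q`. -/
def orbitalBand (q k : R3) : ℂ := Complex.exp (Complex.I * ((-(k ⬝ᵥ q) : ℝ) : ℂ))

theorem contDiff_orbitalBand (q : R3) : ContDiff ℝ ∞ (orbitalBand q) :=
  (contDiff_const.mul (Complex.ofRealCLM.contDiff.comp
    (contDiff_dotProduct contDiff_id contDiff_const).neg)).cexp

theorem orbitalBand_transformsAs (q : R3) (hq : ∀ h ∈ F222.G a b c, h q - q ∈ lattice a b c) :
    TransformsAs (singleOrbital ρ q hq) (orbital a b c q hq ρ).induced (orbitalBand q) := by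
  refine ⟨⟨contDiff_orbitalBand q, fun k => norm_exp_I_mul _, fun K k => ?_⟩, fun _ => 1,
    contDiff_const, fun _ => by simp, fun _ _ _ => rfl, fun h k => ?_⟩
  · change (Circle.exp ((K : R3) ⬝ᵥ q) : ℂ) * orbitalBand q (k + K) = orbitalBand q k
    rw [Circle.coe_exp, orbitalBand, orbitalBand, ← Complex.exp_add, add_dotProduct]
    congr 1
    push_cast
    ring
  · change Complex.exp _ • ((ρ ⟨(h : Aff).linear, h.2.1⟩).1 0 0 * ((1 : ℂ) • orbitalBand q k)) =
      (orbital a b c q hq ρ).induced k h 0 0 • ((1 : ℂ) • orbitalBand q ((h : Aff).linear k))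
    have hk : (h : Aff).linear k ⬝ᵥ ((h : Aff) q - q) =
        (h : Aff).linear k ⬝ᵥ (h : Aff) 0 + (k ⬝ᵥ q - (h : Aff).linear k ⬝ᵥ q) := by
      rw [aff_site_sub, dotProduct_add, dotProduct_sub]
      congr 2
      exact rot_dotProduct_rot h.2.1 _ _
    have he : Complex.exp (-Complex.I * (((h : Aff).linear k ⬝ᵥ (h : Aff) 0 : ℝ) : ℂ)) *
        orbitalBand q k =
        Complex.exp (-Complex.I * (((h : Aff).linear k ⬝ᵥ ((h : Aff) q - q) : ℝ) : ℂ)) *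
          orbitalBand q ((h : Aff).linear k) := by
      rw [hk, orbitalBand, orbitalBand, ← Complex.exp_add, ← Complex.exp_add]
      congr 1
      push_cast
      ring
    rw [orbital_induced_apply, one_smul, one_smul, smul_eq_mul, smul_eq_mul, mul_left_comm, he,
      mul_right_comm, mul_comm]
    rfl

theorem berryConnection_orbitalBand (q k : R3) : berryConnection (orbitalBand q) k = q := by
  refine dotProduct_eq _ _ fun v => ?_
  have hd : DifferentiableAt ℝ (fun k : R3 => k ⬝ᵥ q) k :=
    (contDiff_dotProduct (n := ∞) contDiff_id contDiff_const).differentiable (by simp) k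
  have hf : fderiv ℝ (fun k : R3 => -(k ⬝ᵥ q)) k v = -(v ⬝ᵥ q) := by
    rw [fderiv_fun_neg, neg_apply, fderiv_dotProduct differentiableAt_fun_id (by fun_prop)]
    simp
  rw [berryConnection_dotProduct_of_map_eq (LinearIsometryEquiv.refl ℂ ℂ)
    (w := fun _ : R3 => (1 : ℂ)) (α := fun k => -(k ⬝ᵥ q)) (g := id)
    ((contDiff_orbitalBand q).differentiable (by simp) k) (by fun_prop) (by simp)
    hd.neg (by fun_prop) (fun k => by simp [orbitalBand]) v, hf,
    berryConnection_dotProduct]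
  simp [dotProduct_comm v q]

theorem berryCurvature_orbitalBand (q k : R3) : berryCurvature (orbitalBand q) k = 0 := by
  rw [berryCurvature, show berryConnection (orbitalBand q) = fun _ => q from
    funext (berryConnection_orbitalBand q)]
  ext i
  fin_cases i <;> simp [curl]

theorem wilson_orbitalBand (q K : R3) :
    wilson (orbitalBand q) K = Complex.exp (Complex.I * ((K ⬝ᵥ q : ℝ) : ℂ)) := by
  simp only [wilson, berryConnection_orbitalBand, intervalIntegral.integral_const, sub_zero,
    one_smul, dotProduct_comm q K]

end SingleOrbital

end F222

end

open BandRep F222 in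
theorem mainTheorem5 (a b c : ℝ) (ha : 0 < a) (hb : 0 < b) (hc : 0 < c)
    (H : Type*) [NormedAddCommGroup H] [InnerProductSpace ℂ H] :
    -- the site-symmetry groups of the `4a` and `4b` sites are copies of `D₂`
    Function.Bijective (siteRot a b c site4a) ∧
    Function.Bijective (siteRot a b c (site4b c)) ∧
    -- the irreducible representations of `D₂` are one-dimensional
    (∀ (V : Type) [AddCommGroup V] [Module ℂ V] (σ : Representation ℂ D2 V),
      σ.IsIrreducible → Module.finrank ℂ V = 1) ∧
    -- for each such representation `ρ` of `D₂`:
    ∀ ρ : D2 →* Matrix.unitaryGroup (Fin 1) ℂ,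
      -- the induced representations are EBRs
      IsEBR (rho4a a b c ρ) ∧ IsEBR (rho4b a b c ρ) ∧
      -- explicit form of the EBR induced from `4a`, for `h = {E|t}{R|0}`
      (∀ k (h : F222.G a b c) i j,
        rho4a a b c ρ k h i j =
          Complex.exp (-Complex.I * (((h : Aff).linear k ⬝ᵥ (h : Aff) 0 : ℝ) : ℂ)) *
            (ρ ⟨(h : Aff).linear, h.2.1⟩).1 i.1 j.1) ∧
      -- explicit form of the EBR induced from `4b`, with `t' = t` for `R = E, C_{2,001}`
      -- and `t' = t - t_z` for `R = C_{2,100}, C_{2,010}`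
      (∀ k (h : F222.G a b c) i j,
        ((h : Aff).linear = 1 ∨ (h : Aff).linear = C2z →
          rho4b a b c ρ k h i j =
            Complex.exp (-Complex.I * (((h : Aff).linear k ⬝ᵥ (h : Aff) 0 : ℝ) : ℂ)) *
              (ρ ⟨(h : Aff).linear, h.2.1⟩).1 i.1 j.1) ∧
        ((h : Aff).linear = C2x ∨ (h : Aff).linear = C2y →
          rho4b a b c ρ k h i j =
            Complex.exp (-Complex.I *
              (((h : Aff).linear k ⬝ᵥ ((h : Aff) 0 - tz a b c) : ℝ) : ℂ)) *
              (ρ ⟨(h : Aff).linear, h.2.1⟩).1 i.1 j.1)) ∧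
      -- they are irrep-equivalent but not homotopically equivalent
      IrrepEquivalent (rho4a a b c ρ) (rho4b a b c ρ) ∧
      ¬ HomotopicallyEquivalent (rho4a a b c ρ) (rho4b a b c ρ) ∧
      -- `M` relates them; it is the only gauge transformation that does so, up to phases which
      -- are invariant under `D₂`, and the only plane wave `e^{-i k · r}`
      GaugeRelated (F222.M c) (rho4a a b c ρ) (rho4b a b c ρ) ∧
      (∀ N : R3 → Matrix (Fin 1 × Fin 1) (Fin 1 × Fin 1) ℂ,
        (∀ k, N k ∈ Matrix.unitaryGroup (Fin 1 × Fin 1) ℂ) →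
        (GaugeRelated N (rho4a a b c ρ) (rho4b a b c ρ) ↔
          ∃ φ : R3 → ℂ, (∀ k, ‖φ k‖ = 1) ∧ (∀ R ∈ D2, ∀ k, φ (R k) = φ k) ∧
            ∀ k, N k = φ k • F222.M c k)) ∧
      (∀ r : R3, GaugeRelated (planeWave r) (rho4a a b c ρ) (rho4b a b c ρ) ↔
        r = site4b c) ∧
      -- `M` is not periodic, and no continuous gauge transformation relating them is
      (∀ k, F222.M c (k + g1 a b c) = -F222.M c k ∧ F222.M c (k + g2 a b c) = -F222.M c k ∧
        F222.M c (k + g3 a b c) = -F222.M c k) ∧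
      ¬ BZPeriodic (F222.G a b c) (F222.M c) ∧
      (¬ ∃ N : R3 → Matrix (Fin 1 × Fin 1) (Fin 1 × Fin 1) ℂ,
        (∀ k, N k ∈ Matrix.unitaryGroup (Fin 1 × Fin 1) ℂ) ∧ Continuous N ∧
        BZPeriodic (F222.G a b c) N ∧ GaugeRelated N (rho4a a b c ρ) (rho4b a b c ρ)) ∧
      -- every symmetric band has a well-defined invariant `n` modulo `4`
      (∀ (X : BlochSpace (F222.G a b c) H) (u : R3 → H), IsSymmetricBand X u →
        ∃! n : ZMod 4, IsBerryInvariant a b c u n) ∧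
      -- it equals `0` for bands that transform as the `4a` EBR, `2` for the `4b` EBR
      (∀ (X : BlochSpace (F222.G a b c) H) (u : R3 → H), TransformsAs X (rho4a a b c ρ) u →
        IsSymmetricBand X u ∧ IsBerryInvariant a b c u 0) ∧
      (∀ (X : BlochSpace (F222.G a b c) H) (u : R3 → H), TransformsAs X (rho4b a b c ρ) u →
        IsSymmetricBand X u ∧ IsBerryInvariant a b c u 2) ∧
      -- such bands exist, with zero curvature and `W_{g_j} = ±1`, when the Hilbert space consists
      -- of a single orbital at the site
      (∃ (X : BlochSpace (F222.G a b c) ℂ) (u : R3 → ℂ),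
        (∀ K z, X.boost K z = Complex.exp (Complex.I * (((K : R3) ⬝ᵥ site4a : ℝ) : ℂ)) * z) ∧
        TransformsAs X (rho4a a b c ρ) u ∧ (∀ k, berryCurvature u k = 0) ∧
        wilson u (g1 a b c) = 1 ∧ wilson u (g2 a b c) = 1 ∧ wilson u (g3 a b c) = 1) ∧
      (∃ (X : BlochSpace (F222.G a b c) ℂ) (u : R3 → ℂ),
        (∀ K z, X.boost K z = Complex.exp (Complex.I * (((K : R3) ⬝ᵥ site4b c : ℝ) : ℂ)) * z) ∧
        TransformsAs X (rho4b a b c ρ) u ∧ (∀ k, berryCurvature u k = 0) ∧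
        wilson u (g1 a b c) = -1 ∧ wilson u (g2 a b c) = -1 ∧ wilson u (g3 a b c) = -1) := by
  have ha0 := ha.ne'
  have hb0 := hb.ne'
  have hc0 := hc.ne'
  obtain ⟨hq1, hq2, hq3⟩ := recip_dotProduct_site4b (a := a) (b := b) hc0
  have hπ : Complex.exp (Complex.I * (Real.pi : ℂ)) = -1 := by
    rw [mul_comm, Complex.exp_pi_mul_I]
  have hπ' : Complex.exp (Complex.I * ((-Real.pi : ℝ) : ℂ)) = -1 := by
    rw [Complex.ofReal_neg, mul_neg, Complex.exp_neg, hπ]; norm_num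
  refine ⟨siteRot_bijective a b c _ (site4a_perm a b c),
    siteRot_bijective a b c _ (site4b_perm a b c),
    fun V _ _ σ hσ => finrank_eq_one_of_isIrreducible V σ hσ, fun ρ => ⟨
    isEBR_of_card_eq_one (Orbital.isBandRep_induced _) rfl,
    isEBR_of_card_eq_one (Orbital.isBandRep_induced _) rfl,
    rho4a_apply, fun k h i j => ⟨fun hR => ?_, fun hR => ?_⟩, irrepEquivalent_rho,
    not_homotopicallyEquivalent_rho ha0 hb0 hc0, ?_, fun N hN => gaugeRelated_rho_iff_exists hN,
    gaugeRelated_planeWave_iff, M_add_recip hc0, not_bzPeriodic_M ha0 hb0 hc0,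
    not_exists_continuous_bzPeriodic ha0 hb0 hc0,
    fun X u hu => existsUnique_isBerryInvariant ha0 hb0 hc0 hu,
    fun X u hT => ⟨isSymmetricBand_of_transformsAs hT, ?_⟩,
    fun X u hT => ⟨isSymmetricBand_of_transformsAs hT, ?_⟩,
    ⟨singleOrbital ρ site4a (site4a_perm a b c), orbitalBand site4a, fun K z => ?_,
      orbitalBand_transformsAs ρ _ _, berryCurvature_orbitalBand _, ?_, ?_, ?_⟩,
    ⟨singleOrbital ρ (site4b c) (site4b_perm a b c), orbitalBand (site4b c), fun K z => ?_,
      orbitalBand_transformsAs ρ _ _, berryCurvature_orbitalBand _, ?_, ?_, ?_⟩⟩⟩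
  · rw [rho4b_apply, (rot_site4b a b).1 hR, add_zero]
  · rw [rho4b_apply, (rot_site4b a b).2 hR, ← sub_eq_add_neg]
  · rw [M_eq_planeWave, gaugeRelated_planeWave_iff]
  · have := isBerryInvariant_of_transformsAs ha0 hb0 hc0 hT (l := 0) (by simp [site4a])
    rwa [Int.cast_zero] at this
  · have := isBerryInvariant_of_transformsAs ha0 hb0 hc0 hT (l := 2)
      (by rw [hq1]; push_cast; ring)
    rwa [Int.cast_ofNat] at this
  · change (Circle.exp ((K : R3) ⬝ᵥ site4a) : ℂ) * z = _
    rw [Circle.coe_exp, mul_comm Complex.I]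
  iterate 3 · rw [wilson_orbitalBand]; simp [site4a]
  · change (Circle.exp ((K : R3) ⬝ᵥ site4b c) : ℂ) * z = _
    rw [Circle.coe_exp, mul_comm Complex.I]
  · rw [wilson_orbitalBand, hq1, hπ]
  · rw [wilson_orbitalBand, hq2, hπ]
  · rw [wilson_orbitalBand, hq3, hπ']
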